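/- All graphs are finite, simple and connected. A \emph{cactus} is a graph whose cycles are pairwise edge-disjoint. A \emph{grape} rooted at $u$ is a cactus with at least one cycle, all of whose cycles contain $u$; its \emph{berries} are the subgraphs induced by $V(K)\cup\{u\}$ for the connected components $K$ of $G-u$. A \emph{$k$-liec} is a (not necessarily proper) edge colouring with $k$ available colours in which, for every edge $xy$ of any colour $c$, $d^c(x)\ne d^c(y)$ (such an edge $xy$ is called locally irregular), where $d^c(x)$ is the number of edges of colour $c$ at $x$; a graph is \emph{colorable} if it has a $k$-liec for some $k$. A graph is \emph{totally trimmed} if it contains no path of length $\ge 5$ whose internal vertices all have degree $2$ in the graph, and no such path of length $\ge 3$ that starts at a leaf. \emph{Alternative berries} (rooted at $u$). A \emph{leg} at $x$ is a path of length $2$ hanging at $x$; a \emph{fork} at $x$ is an edge $xy$ to a new vertex $y$ that carries two legs. $B_1$ is the triangle $uvw$; $B_2$ is the triangle $uvw$ with one leg at each of $v,w$, or with one leg at exactly one of $v,w$; $B_3$ is the triangle $uvw$ with two legs at each of $v,w$; $B_4$ is the triangle $uvw$ with one leg and one fork at each of $v,w$; $B_5$ is a $5$-cycle through $u$, where $v,w$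 are the neighbours of $u$, with one leg and one fork at each of $v,w$; $B_6$ is the triangle $uvw$ with one leg and two forks at each of $v,w$; $B_7$ is a single fork at $u$. All other berries are \emph{standard}. $B'$ is the grape with exactly three berries $B_1,B_1,B_7$. Let $H$ be a berry with root $u$, let $v$ be a neighbour of $u$ in $H$ and, if $d_H(u)=2$, let $w$ be the other one (either labelling of the two neighbours is allowed). Consider colourings of $E(H)$ with three available colours; colour degrees and local irregularity are taken in $H$. \begin{itemize} \item \emph{Standard primary}: every edge not incident to $u$ is locally irregular, all edges at $u$ have the same colour $c$, and $d^c(x)\le 2$ for every neighbour $x$ of $u$. \item \emph{Alternative primary}: if $d_H(u)=1$, a $3$-liec of $H$ in which all edges at $v$ have the same colour; if $d_H(u)=2$, every edge other than $uv$ is locally irregular, $uv$ and $uw$ have distinct colours $c$ and $a$, $d^c(v)\le 2$, $d^a(w)\in\{2,4\}$, and $d^c(v)=2$ implies $d^a(w)=4$. \item \emph{Primary}: alternative primary if $H$ is alternative, standard primary if $H$ is standard. \item \emph{Secondary} (only for $H\ne B_7$): if $d_H(u)=1$, every edge not incident to $u$ is locally irregular and $d^c(v)\ne 2$, where $c$ is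 the colour of $uv$; if $d_H(u)=2$, every edge other than $uv$ is locally irregular, $uv$ and $uw$ have distinct colours $c$ and $a$, $d^c(v)\le 2$, and $d^c(v)=2$ implies $d^a(w)\ge 3$. \item \emph{Tertiary} (only for $d_H(u)=2$): every edge other than $uv$ is locally irregular, $uv$ and $uw$ have the same colour $c$, $d^c(v)\le 2$ and $d^c(w)\in\{3,4\}$. \end{itemize} \textbf{Statement.} Let $G$ be a grape rooted at $u$ with at least two cycles. \begin{enumerate} \item If $G$ is totally trimmed and $G$ is not isomorphic to $B'$, then $G$ admits a $3$-liec whose restriction to every berry of $G$ is a primary, a secondary or a tertiary colouring of that berry. \item If $G$ is colorable (totally trimmed or not), then $G$ admits a $3$-liec. \end{enumerate} -/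

import Mathlib

namespace CactusGrape

/-! Degrees, locally irregular graphs and locally irregular edge colorings. -/

/-- The degree of a vertex, as the number of its neighbours. -/
noncomputable def deg {V : Type*} (G : SimpleGraph V) (v : V) : ℕ :=
  (G.neighborSet v).ncard

/-- A graph is locally irregular if adjacent vertices always have distinct degrees. -/
def IsLocallyIrregular {V : Type*} (G : SimpleGraph V) : Prop :=
  ∀ x y, G.Adj x y → deg G x ≠ deg G y

/-- The `k`-degree of `v`: the number of edges of color `k` at `v`. -/
noncomputable def colorDeg {V K : Type*} {G : SimpleGraph V} (C : G.EdgeLabeling K)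
    (k : K) (v : V) : ℕ :=
  deg (C.labelGraph k) v

/-- A locally irregular edge coloring: every color induces a locally irregular subgraph. -/
def IsLiec {V K : Type*} {G : SimpleGraph V} (C : G.EdgeLabeling K) : Prop :=
  ∀ k, IsLocallyIrregular (C.labelGraph k)

/-- A graph is colorable if it admits a locally irregular `k`-edge coloring for some `k`. -/
def IsColorable {V : Type*} (G : SimpleGraph V) : Prop :=
  ∃ (k : ℕ) (C : G.EdgeLabeling (Fin k)), IsLiec C

/-- The edge `xy` is locally irregular by `C`: its ends have distinct degrees in its color. -/
def EdgeIrregular {V K : Type*} {G : SimpleGraph V} (C : G.EdgeLabeling K) (x y : V) : Prop :=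
  ∀ k, (C.labelGraph k).Adj x y → colorDeg C k x ≠ colorDeg C k y

/-! Cacti, grapes, berries, trimming. -/

/-- The cycles of a graph, each one given by its set of edges. -/
def cycles {V : Type*} (G : SimpleGraph V) : Set (Set (Sym2 V)) :=
  {s | ∃ (x : V) (p : G.Walk x x), p.IsCycle ∧ s = {e | e ∈ p.edges}}

/-- A cactus: a connected graph in which distinct cycles are edge disjoint. -/
def IsCactus {V : Type*} (G : SimpleGraph V) : Prop :=
  G.Connected ∧ (cycles G).Pairwise Disjoint

/-- A grape rooted at `u`: a cactus with at least one cycle all of whose cycles contain `u`. -/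
def IsGrape {V : Type*} (G : SimpleGraph V) (u : V) : Prop :=
  IsCactus G ∧ (cycles G).Nonempty ∧ ∀ s ∈ cycles G, ∃ e ∈ s, u ∈ e

/-- For a connected component `K` of `G - u`, the vertex set `V(K) ∪ {u}` of the berry of `K`. -/
def berrySet {V : Type*} (G : SimpleGraph V) (u : V)
    (K : (G.induce ({u}ᶜ : Set V)).ConnectedComponent) : Set V :=
  insert u (Subtype.val '' K.supp)

/-- The berry of the component `K` of `G - u`: the subgraph induced by `V(K) ∪ {u}`. -/
def berry {V : Type*} (G : SimpleGraph V) (u : V)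
    (K : (G.induce ({u}ᶜ : Set V)).ConnectedComponent) : SimpleGraph (berrySet G u K) :=
  G.induce (berrySet G u K)

/-- The root `u` as a vertex of the berry. -/
def berryRoot {V : Type*} (G : SimpleGraph V) (u : V)
    (K : (G.induce ({u}ᶜ : Set V)).ConnectedComponent) : berrySet G u K :=
  ⟨u, Set.mem_insert u _⟩

/-- The restriction to a berry of an edge coloring of `G`. -/
def berryColoring {V L : Type*} {G : SimpleGraph V} (C : G.EdgeLabeling L) (u : V)
    (K : (G.induce ({u}ᶜ : Set V)).ConnectedComponent) : (berry G u K).EdgeLabeling L :=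
  C.pullback (SimpleGraph.Embedding.induce (berrySet G u K)).toHom

/-- An ear: a path all of whose internal vertices have degree two in the graph. -/
def IsEar {V : Type*} {G : SimpleGraph V} {x y : V} (p : G.Walk x y) : Prop :=
  p.IsPath ∧ ∀ z ∈ p.support, z ≠ x → z ≠ y → deg G z = 2

/-- A graph is totally trimmed if it has no ear of length at least five and no pending path
(an ear that starts at a leaf) of length at least three. -/
def IsTotallyTrimmed {V : Type*} (G : SimpleGraph V) : Prop :=
  (∀ (x y : V) (p : G.Walk x y), IsEar p → p.length < 5) ∧
  (∀ (x y : V) (p : G.Walk x y), IsEar p → deg G x = 1 → p.length < 3)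

/-! The alternative berries `B₁, …, B₇` (all rooted at the vertex `0`) and the grape `B'`. -/

/-- The graph on `Fin n` with the listed edges. -/
def ofEdges (n : ℕ) (l : List (Fin n × Fin n)) : SimpleGraph (Fin n) :=
  SimpleGraph.fromRel fun i j => (i, j) ∈ l

/-- Two rooted graphs are isomorphic. -/
def RootedIso {V W : Type*} (G : SimpleGraph V) (u : V) (H : SimpleGraph W) (r : W) : Prop :=
  ∃ e : G ≃g H, e u = r

/-- A triangle. -/
def B1 : SimpleGraph (Fin 3) := ofEdges 3 [(0, 1), (0, 2), (1, 2)]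

/-- A triangle `0 1 2` with a path of length two hanging at `1` and another one at `2`. -/
def B2 : SimpleGraph (Fin 7) :=
  ofEdges 7 [(0, 1), (0, 2), (1, 2), (1, 3), (3, 4), (2, 5), (5, 6)]

/-- The variant of `B2` in which a path of length two hangs at one of the two vertices only. -/
def B2' : SimpleGraph (Fin 5) := ofEdges 5 [(0, 1), (0, 2), (1, 2), (2, 3), (3, 4)]

/-- A triangle `0 1 2` with two paths of length two hanging at each of `1` and `2`. -/
def B3 : SimpleGraph (Fin 11) :=
  ofEdges 11 [(0, 1), (0, 2), (1, 2), (1, 3), (3, 4), (1, 5), (5, 6),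
    (2, 7), (7, 8), (2, 9), (9, 10)]

/-- A triangle `0 1 2`; at each of `1` and `2` there hang a path of length two and an edge to a
further vertex (`5`, resp. `12`) that carries two paths of length two. -/
def B4 : SimpleGraph (Fin 17) :=
  ofEdges 17 [(0, 1), (0, 2), (1, 2),
    (1, 3), (3, 4), (1, 5), (5, 6), (6, 7), (5, 8), (8, 9),
    (2, 10), (10, 11), (2, 12), (12, 13), (13, 14), (12, 15), (15, 16)]

/-- The same as `B4`, with the triangle replaced by the 5-cycle `0 1 17 18 2`. -/
def B5 : SimpleGraph (Fin 19) :=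
  ofEdges 19 [(0, 1), (0, 2), (1, 17), (17, 18), (18, 2),
    (1, 3), (3, 4), (1, 5), (5, 6), (6, 7), (5, 8), (8, 9),
    (2, 10), (10, 11), (2, 12), (12, 13), (13, 14), (12, 15), (15, 16)]

/-- A triangle `0 1 2`; at each of `1` and `2` there hang a path of length two and edges to two
further vertices (`5`, `10`, resp. `17`, `22`), each carrying two paths of length two. -/
def B6 : SimpleGraph (Fin 27) :=
  ofEdges 27 [(0, 1), (0, 2), (1, 2),
    (1, 3), (3, 4), (1, 5), (5, 6), (6, 7), (5, 8), (8, 9),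
    (1, 10), (10, 11), (11, 12), (10, 13), (13, 14),
    (2, 15), (15, 16), (2, 17), (17, 18), (18, 19), (17, 20), (20, 21),
    (2, 22), (22, 23), (23, 24), (22, 25), (25, 26)]

/-- The tree in which the only neighbour `1` of the root carries two paths of length two. -/
def B7 : SimpleGraph (Fin 6) := ofEdges 6 [(0, 1), (1, 2), (2, 3), (1, 4), (4, 5)]

/-- The grape `B'`, with root `0`, whose berries are `B₁`, `B₁` and `B₇`. -/
def BPrime : SimpleGraph (Fin 10) :=
  ofEdges 10 [(0, 1), (0, 2), (1, 2), (0, 3), (0, 4), (3, 4),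
    (0, 5), (5, 6), (6, 7), (5, 8), (8, 9)]

/-- The alternative berries; all other berries are standard. -/
def IsAlternative {V : Type*} (G : SimpleGraph V) (u : V) : Prop :=
  RootedIso G u B1 0 ∨ RootedIso G u B2 0 ∨ RootedIso G u B2' 0 ∨ RootedIso G u B3 0 ∨
  RootedIso G u B4 0 ∨ RootedIso G u B5 0 ∨ RootedIso G u B6 0 ∨ RootedIso G u B7 0

/-! Colorings of a graph rooted at `u`. The color of an edge `uv` is `c` iff
`(C.labelGraph c).Adj u v`. -/

/-- Standard primary coloring. -/
def IsStandardPrimary {V : Type*} {G : SimpleGraph V} (u : V) (C : G.EdgeLabeling (Fin 3)) :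
    Prop :=
  (deg G u = 1 ∨ deg G u = 2) ∧
  (∀ x y, G.Adj x y → x ≠ u → y ≠ u → EdgeIrregular C x y) ∧
  ∃ c, ∀ v, G.Adj u v → (C.labelGraph c).Adj u v ∧ colorDeg C c v ≤ 2

/-- Alternative primary coloring. -/
def IsAlternativePrimary {V : Type*} {G : SimpleGraph V} (u : V) (C : G.EdgeLabeling (Fin 3)) :
    Prop :=
  (deg G u = 1 ∧ IsLiec C ∧
    ∃ v c, G.Adj u v ∧ ∀ x, G.Adj v x → (C.labelGraph c).Adj v x) ∨
  (deg G u = 2 ∧ ∃ v w c a, v ≠ w ∧ c ≠ a ∧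
    (C.labelGraph c).Adj u v ∧ (C.labelGraph a).Adj u w ∧
    (∀ x y, G.Adj x y → s(x, y) ≠ s(u, v) → EdgeIrregular C x y) ∧
    colorDeg C c v ≤ 2 ∧ (colorDeg C a w = 2 ∨ colorDeg C a w = 4) ∧
    (colorDeg C c v = 2 → colorDeg C a w = 4))

/-- Primary coloring of a berry: a standard primary coloring if the berry is standard,
an alternative primary coloring if the berry is alternative. -/
def IsPrimary {V : Type*} {G : SimpleGraph V} (u : V) (C : G.EdgeLabeling (Fin 3)) : Prop :=
  (IsAlternative G u → IsAlternativePrimary u C) ∧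
  (¬ IsAlternative G u → IsStandardPrimary u C)

/-- Secondary coloring (not defined for `B₇`). -/
def IsSecondary {V : Type*} {G : SimpleGraph V} (u : V) (C : G.EdgeLabeling (Fin 3)) : Prop :=
  ¬ RootedIso G u B7 0 ∧
  ((deg G u = 1 ∧
    (∀ x y, G.Adj x y → x ≠ u → y ≠ u → EdgeIrregular C x y) ∧
    ∃ v c, (C.labelGraph c).Adj u v ∧ colorDeg C c v ≠ 2) ∨
  (deg G u = 2 ∧ ∃ v w c a, v ≠ w ∧ c ≠ a ∧
    (C.labelGraph c).Adj u v ∧ (C.labelGraph a).Adj u w ∧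
    (∀ x y, G.Adj x y → s(x, y) ≠ s(u, v) → EdgeIrregular C x y) ∧
    colorDeg C c v ≤ 2 ∧ (colorDeg C c v = 2 → 3 ≤ colorDeg C a w)))

/-- Tertiary coloring. -/
def IsTertiary {V : Type*} {G : SimpleGraph V} (u : V) (C : G.EdgeLabeling (Fin 3)) : Prop :=
  deg G u = 2 ∧ ∃ v w c, v ≠ w ∧
    (C.labelGraph c).Adj u v ∧ (C.labelGraph c).Adj u w ∧
    (∀ x y, G.Adj x y → s(x, y) ≠ s(u, v) → EdgeIrregular C x y) ∧
    colorDeg C c v ≤ 2 ∧ (colorDeg C c w = 3 ∨ colorDeg C c w = 4)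

end CactusGrape

namespace CactusGrape

/-! Keep, for each component of `G - u`, one edge to the root. The result is a spanning tree. A
`Frame` records its parent function, the set `Z` of lower ends of the deleted edges, and the child
`top x` of the root above each vertex `x`. The tree is coloured from the leaves up: all that the
parent of `x` needs to know is the colour `o` of the edge above `x` and the number `q` of edges of
colour `o` at `x`. The predicate `Val` says which pairs are attainable.

The central observation is that a vertex blocks at most one class size: there is a number `n` such
that for every `e ≠ n` its subtree has a colouring with `q ≠ e` (`Blocks`, `BlocksOn`). Colouring
below a vertex thus becomes a counting problem, `Distributable`: split the children into colour
classes so that no child lies in a class of its blocked size. Solving it also yields the blocked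
value one level higher, which keeps the induction going; away from `Z` this value is at most `2`.

For `z ∈ Z` the colour `κ z` of `uz` is kept off all other edges at `z`, so `uz` is locally
irregular once the root has two edges of that colour. This costs `z` one colour, and its blocked
value can become `3`, but only if `z` has exactly two children (`Anc.exists_blocksOn`). Keeping at
each cycle the edge to the root neighbour of larger degree makes up for it.

At the root only the values of its children matter. A cycle that is `Long` receives a single colour
at `u`, with value at most `2`; any other cycle receives two colours, with value `2` or `3`. Acyclic
berries have value at most `2`, except that `B₇` needs value `3`, its three edges at the neighbour
of `u` having one colour. Colours at the root then exist (`exists_isRootColoring`) unless there are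
just three berries: two cycles that are not `Long` and one `B₇`. If one of these cycles can take a
value of at least `3`, `exists_isRootColoring_special` applies; otherwise both are bare triangles
and the grape is `B'`. Single-coloured cycles and acyclic berries are primary, two-coloured cycles
secondary, so tertiary colourings do not occur. -/

open Finset

/-! ### Distributing the children of a vertex into color classes -/

/-- The size of the class of color `j` at a vertex with children `s` whose parent edge has color
`o` and the edges to whose children are colored by `A`. -/
def classSize {V : Type*} (s : Finset V) (A : V → Fin 3) (o j : Fin 3) : ℕ :=
  (if o = j then 1 else 0) + #{y ∈ s | A y = j}

/-- Child `y` may be put into any class whose size is not `b y`. The children can be distributed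
such that the class `0` of the parent edge has size `q`. -/
def Distributable {V : Type*} (s : Finset V) (b : V → ℕ) (q : ℕ) : Prop :=
  ∃ A : V → Fin 3, (∀ y ∈ s, classSize s A 0 (A y) ≠ b y) ∧ classSize s A 0 0 = q

/-- As `Distributable`, without using color `2`. -/
def Distributable₂ {V : Type*} (s : Finset V) (b : V → ℕ) (q : ℕ) : Prop :=
  ∃ A : V → Fin 3, (∀ y ∈ s, A y ≠ 2) ∧ (∀ y ∈ s, classSize s A 0 (A y) ≠ b y) ∧
    classSize s A 0 0 = q

section
variable {V : Type*} {s : Finset V} {b : V → ℕ} {q : ℕ}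

lemma Distributable₂.distributable (h : Distributable₂ s b q) : Distributable s b q := by
  obtain ⟨A, -, h⟩ := h
  exact ⟨A, h⟩

/-- Distributing by two disjoint sets: `t` goes to the parent class, the rest to class `1`. -/
lemma distributable₂_of_subset [DecidableEq V] (t : Finset V) (ht : t ⊆ s)
    (h0 : ∀ y ∈ t, b y ≠ #t + 1) (h1 : ∀ y ∈ s, y ∉ t → b y ≠ #s - #t) :
    Distributable₂ s b (#t + 1) := by
  have e0 : ({y ∈ s | (if y ∈ t then (0 : Fin 3) else 1) = 0} : Finset V) = t := by
    ext y; by_cases hy : y ∈ t <;> simp [hy]; exact ht hy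
  have e1 : ({y ∈ s | (if y ∈ t then (0 : Fin 3) else 1) = 1} : Finset V) = s \ t := by
    ext y; by_cases hy : y ∈ t <;> simp [hy]
  refine ⟨fun y => if y ∈ t then 0 else 1, fun y _ => ?_, fun y hy => ?_, ?_⟩
  · by_cases hy : y ∈ t <;> simp [hy]
  · by_cases hyt : y ∈ t
    · simp only [hyt, if_true, classSize, e0]
      have := h0 y hyt; omega
    · simp only [hyt, if_false, classSize, e1]
      rw [card_sdiff_of_subset ht]
      have := h1 y hy hyt
      simp; omega
  · simp only [classSize, e0]; simp; omega

lemma distributable₂_all_own (h : ∀ y ∈ s, b y ≠ #s + 1) : Distributable₂ s b (#s + 1) := by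
  classical
  exact distributable₂_of_subset s subset_rfl h (fun y hy hn => absurd hy hn)

lemma distributable₂_none_own (h : ∀ y ∈ s, b y ≠ #s) : Distributable₂ s b 1 := by
  classical
  simpa using distributable₂_of_subset (s := s) (b := b) ∅ (by simp) (by simp) (by simpa using h)

lemma distributable₂_one_own {x : V} (hx : x ∈ s) (h0 : b x ≠ 2)
    (h1 : ∀ y ∈ s, y ≠ x → b y ≠ #s - 1) : Distributable₂ s b 2 := by
  classical
  simpa using distributable₂_of_subset (s := s) (b := b) {x} (by simpa) (by simpa)
    (by simpa using h1)

lemma distributable₂_all_but_one_own {x : V} (hx : x ∈ s) (h0 : b x ≠ 1)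
    (h1 : ∀ y ∈ s, y ≠ x → b y ≠ #s) : Distributable₂ s b #s := by
  classical
  have hc := card_erase_add_one hx
  have := distributable₂_of_subset (s := s) (b := b) (s.erase x) (erase_subset _ _)
    (by intro y hy; rw [mem_erase] at hy; rw [hc]; exact h1 y hy.2 hy.1)
    (by
      intro y hy hn
      have : y = x := by by_contra h; exact hn (mem_erase.2 ⟨h, hy⟩)
      subst this
      rwa [show #s - #(s.erase y) = 1 by omega])
  rwa [hc] at this

lemma distributable₂_two_own {x y : V} (hx : x ∈ s) (hy : y ∈ s) (hxy : x ≠ y) (hbx : b x ≠ 3)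
    (hby : b y ≠ 3) (h1 : ∀ z ∈ s, b z ≠ #s - 2) : Distributable₂ s b 3 := by
  classical
  have hc : #({x, y} : Finset V) = 2 := card_pair hxy
  have := distributable₂_of_subset (s := s) (b := b) {x, y}
    (by simp [insert_subset_iff, hx, hy]) (by simp [hc, hbx, hby])
    (by intro z hz _; rw [hc]; exact h1 z hz)
  rwa [hc] at this

/-- `t` goes to the parent class, `x` alone to class `2` and the rest to class `1`. -/
lemma distributable_of_subset_of_single [DecidableEq V] (t : Finset V) {x : V} (hx : x ∈ s)
    (ht : t ⊆ s) (hxt : x ∉ t) (h0 : ∀ y ∈ t, b y ≠ #t + 1) (hbx : b x ≠ 1)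
    (h1 : ∀ y ∈ s, y ∉ t → y ≠ x → b y ≠ #s - #t - 1) :
    Distributable s b (#t + 1) := by
  let A : V → Fin 3 := fun y => if y ∈ t then 0 else if y = x then 2 else 1
  have e0 : ({y ∈ s | A y = 0} : Finset V) = t := by
    ext y; by_cases hy : y ∈ t
    · simp [A, hy]; exact ht hy
    · by_cases hyx : y = x <;> simp [A, hy, hyx, hxt]
  have e2 : ({y ∈ s | A y = 2} : Finset V) = {x} := by
    ext y; by_cases hy : y ∈ t
    · simp [A, hy]; rintro rfl; exact hxt hy
    · by_cases hyx : y = x <;> simp [A, hy, hyx, hxt, hx]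
  have e1 : ({y ∈ s | A y = 1} : Finset V) = (s \ t).erase x := by
    ext y; by_cases hy : y ∈ t
    · simp [A, hy]
    · by_cases hyx : y = x <;> simp [A, hy, hyx, hxt]
  refine ⟨A, fun y hy => ?_, ?_⟩
  · by_cases hyt : y ∈ t
    · have : A y = 0 := by simp [A, hyt]
      rw [this, classSize, e0]
      have := h0 y hyt; simp; omega
    · by_cases hyx : y = x
      · have : A y = 2 := by simp [A, hyx, hxt]
        rw [this, classSize, e2]
        subst hyx; simp; omega
      · have : A y = 1 := by simp [A, hyt, hyx]
        rw [this, classSize, e1, card_erase_of_mem (by simp [hx, hxt]), card_sdiff_of_subset ht]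
        have := h1 y hy hyt hyx
        simp; omega
  · rw [classSize, e0]; simp; omega

/-- The children are alone in classes `1` and `2`; this is a use of the third colour. -/
lemma distributable_pair_apart (hs : #s = 2) (h : ∀ y ∈ s, b y ≠ 1) : Distributable s b 1 := by
  classical
  obtain ⟨x, y, hxy, rfl⟩ := card_eq_two.1 hs
  simpa using distributable_of_subset_of_single (b := b) ∅ (x := x) (s := {x, y}) (by simp)
    (by simp) (by simp) (by simp) (h x (by simp))
    (by intro z hz _ _; simpa [hs] using h z hz)

/-- Four children, two of them in the parent class and the others apart. -/
lemma distributable_two_own_two_apart (hs : #s = 4) (h : ∀ y ∈ s, b y = 2) :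
    Distributable s b 3 := by
  classical
  obtain ⟨t, ht, hc⟩ := exists_subset_card_eq (show 2 ≤ #s by omega)
  obtain ⟨x, hx⟩ := card_pos.1 (show 0 < #(s \ t) by rw [card_sdiff_of_subset ht]; omega)
  rw [mem_sdiff] at hx
  have := distributable_of_subset_of_single (s := s) (b := b) t hx.1 ht hx.2
    (by intro y hy; rw [hc, h y (ht hy)]; omega) (by rw [h x hx.1]; omega)
    (by intro y hy _ _; rw [h y hy, hc, hs]; omega)
  rwa [hc] at this

/-- Two children, the second value besides `3`. -/
lemma exists_distributable_pair (hs : #s = 2) :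
    ∃ q, (q = 1 ∨ q = 2) ∧ Distributable s b q := by
  by_cases h2 : ∀ y ∈ s, b y ≠ 2
  · exact ⟨1, .inl rfl, (distributable₂_none_own (by rw [hs]; exact h2)).distributable⟩
  push Not at h2
  obtain ⟨x, hx, hbx⟩ := h2
  by_cases h : ∀ y ∈ s, y ≠ x → b y ≠ 2
  · refine ⟨2, .inr rfl, ?_⟩
    have := distributable₂_all_but_one_own (b := b) hx (by omega) (by rwa [hs])
    rw [hs] at this
    exact this.distributable
  · push Not at h
    obtain ⟨y, hy, hyx, hby⟩ := h
    refine ⟨1, .inl rfl, distributable_pair_apart hs fun z hz => ?_⟩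
    classical
    have : s = {x, y} := by
      refine (eq_of_subset_of_card_le (by simp [insert_subset_iff, hx, hy]) ?_).symm
      rw [hs, card_pair (Ne.symm hyx)]
    rw [this] at hz
    simp at hz
    rcases hz with rfl | rfl <;> omega

/-- Three or more children can share class `1`, whose size then exceeds every blocked value; only at
most two children need care. -/
lemma exists_distributable_le_two (hb : ∀ y ∈ s, b y ≤ 2) :
    ∃ q, (q = 1 ∨ q = 2) ∧ Distributable s b q := by
  obtain h | h | h | h : #s = 0 ∨ #s = 1 ∨ #s = 2 ∨ 3 ≤ #s := by omega
  · exact ⟨1, .inl rfl, (distributable₂_none_own (by simp_all)).distributable⟩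
  · by_cases h1 : ∀ y ∈ s, b y ≠ 1
    · exact ⟨1, .inl rfl, (distributable₂_none_own (by rwa [h])).distributable⟩
    · refine ⟨2, .inr rfl, ?_⟩
      have := distributable₂_all_own (s := s) (b := b) ?_
      · rw [h] at this; exact this.distributable
      · obtain ⟨x, rfl⟩ := card_eq_one.1 h
        simp at h1 ⊢; omega
  · exact exists_distributable_pair h
  · refine ⟨1, .inl rfl, (distributable₂_none_own fun y hy => ?_).distributable⟩
    have := hb y hy; omega

/-- A vertex with exactly one child. -/
lemma distributable₂_single (hs : #s = 1) {x : V} (hx : x ∈ s) :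
    (b x ≠ 2 → Distributable₂ s b 2) ∧ (b x ≠ 1 → Distributable₂ s b 1) := by
  obtain ⟨y, rfl⟩ := card_eq_one.1 hs
  obtain rfl : x = y := by simpa using hx
  exact ⟨fun h => by simpa using distributable₂_all_own (s := {x}) (b := b) (by simpa),
    fun h => distributable₂_none_own (by simpa)⟩

/-- The blocked value of a vertex, given those of its children: at most one child has blocked
value `3`. -/
lemma exists_blocked (x : V) (hb : ∀ y ∈ s, b y ≤ 3) (hx : ∀ y ∈ s, y ≠ x → b y ≤ 2) :
    ∃ n ≤ 2, (∀ e, e ≠ n → ∃ q, q ≠ e ∧ Distributable s b q) ∧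
      (n = 1 → s = ∅ ∨ ∃ y, s = {y} ∧ b y = 2) := by
  -- With two attainable values nothing is blocked. The value `0` encodes this, since a class
  -- containing a child never has size `0`.
  have two : ∀ q₁ q₂, q₁ ≠ q₂ → Distributable s b q₁ → Distributable s b q₂ →
      ∃ n ≤ 2, (∀ e, e ≠ n → ∃ q, q ≠ e ∧ Distributable s b q) ∧
      (n = 1 → s = ∅ ∨ ∃ y, s = {y} ∧ b y = 2) := by
    intro q₁ q₂ hne h₁ h₂
    refine ⟨0, by omega, fun e _ => ?_, by omega⟩
    by_cases h : q₁ = e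
    · exact ⟨q₂, by omega, h₂⟩
    · exact ⟨q₁, h, h₁⟩
  obtain h | h | h : #s = 0 ∨ #s = 1 ∨ 2 ≤ #s := by omega
  · exact ⟨1, by omega, fun e he => ⟨1, he.symm,
      (distributable₂_none_own (by simp_all)).distributable⟩, fun _ => .inl (by simpa using h)⟩
  · obtain ⟨y, rfl⟩ := card_eq_one.1 h
    obtain ⟨h2, h1⟩ := distributable₂_single (b := b) h (mem_singleton_self y)
    by_cases hy1 : b y = 1
    · exact ⟨2, by omega, fun e he => ⟨2, he.symm, (h2 (by omega)).distributable⟩, by omega⟩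
    · by_cases hy2 : b y = 2
      · exact ⟨1, by omega, fun e he => ⟨1, he.symm, (h1 hy1).distributable⟩,
          fun _ => .inr ⟨y, rfl, hy2⟩⟩
      · exact two 1 2 (by omega) (h1 hy1).distributable (h2 hy2).distributable
  by_cases h3 : ∀ y ∈ s, b y ≤ 2
  · obtain ⟨q, hq, h'⟩ := exists_distributable_le_two h3
    refine two q (#s + 1) (by omega) h' (distributable₂_all_own fun y hy => ?_).distributable
    have := h3 y hy; omega
  push Not at h3
  obtain ⟨x', hxs, hx3⟩ := h3
  obtain rfl : x' = x := by by_contra hne; have := hx x' hxs hne; omega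
  have hx3 : b x' = 3 := by have := hb x' hxs; omega
  obtain h | h : #s = 2 ∨ 3 ≤ #s := by omega
  · by_cases h2 : ∀ y ∈ s, b y ≠ 2
    · refine two 1 2 (by omega) (distributable₂_none_own (by rwa [h])).distributable ?_
      have := distributable₂_all_but_one_own (b := b) hxs (by omega)
        (fun y hy _ => by rw [h]; exact h2 y hy)
      rw [h] at this
      exact this.distributable
    · push Not at h2
      obtain ⟨y, hys, hy2⟩ := h2
      have hne : x' ≠ y := by rintro rfl; omega
      classical
      have hs : s = {x', y} := by
        refine (eq_of_subset_of_card_le (by simp [insert_subset_iff, hxs, hys]) ?_).symm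
        rw [h, card_pair hne]
      -- The blocked values are `3` and `2`: either both children are alone, or `y` is alone and
      -- `x'` joins the parent edge in a class of size `2`.
      refine two 1 2 (by omega) (distributable_pair_apart h ?_) ?_
      · rw [hs]; simp; omega
      · have := distributable₂_all_but_one_own (b := b) hys (by omega)
          (by rw [h]; subst hs; simp; omega)
        rw [h] at this
        exact this.distributable
  -- Either `x'` is alone and the others join the parent edge, or all do. The sizes `#s ≥ 3` and `#s
  -- + 1 ≥ 4` exceed the relevant blocked values.
  · refine two #s (#s + 1) (by omega)
      (distributable₂_all_but_one_own hxs (by omega) fun y hy hne => ?_).distributable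
      (distributable₂_all_own fun y hy => ?_).distributable
    · have := hx y hy hne; omega
    · have := hb y hy; omega

/-- At least two children: the parent class can be made to have size `2` or `3`, unless there are
just two children and one of them has blocked value `3`. -/
lemma exists_distributable_two_or_three (x : V) (hs : 2 ≤ #s)
    (hx : ∀ y ∈ s, y ≠ x → b y ≤ 2) (h2 : #s = 2 → ∀ y ∈ s, b y ≤ 2) :
    ∃ q, (q = 2 ∨ q = 3) ∧ Distributable s b q := by
  obtain h | h | h : #s = 2 ∨ #s = 3 ∨ 4 ≤ #s := by omega
  · refine ⟨3, .inr rfl, ?_⟩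
    have := distributable₂_all_own (s := s) (b := b) (fun y hy => by have := h2 h y hy; omega)
    rw [h] at this
    exact this.distributable
  · by_cases h1 : ∃ y ∈ s, b y ≠ 1 ∧ ∀ z ∈ s, z ≠ y → b z ≠ 3
    · obtain ⟨y, hy, hy1, hz⟩ := h1
      have := distributable₂_all_but_one_own hy hy1 (by rwa [h])
      rw [h] at this
      exact ⟨3, .inr rfl, this.distributable⟩
    · push Not at h1
      -- If `b y ≠ 1`, some other `z` has `b z = 3`; then `b z ≠ 1`, so a further `w ≠ z` has `b w =
      -- 3`. But only `x` can have blocked value `3`.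
      have key : ∀ y ∈ s, b y = 1 := by
        by_contra hcon
        push Not at hcon
        obtain ⟨y, hy, hy1⟩ := hcon
        obtain ⟨z, hz, hzy, hz3⟩ := h1 y hy hy1
        obtain ⟨w, hw, hwz, hw3⟩ := h1 z hz (by omega)
        have e1 : z = x := by by_contra hne; have := hx z hz hne; omega
        have e2 : w = x := by by_contra hne; have := hx w hw hne; omega
        exact hwz (e2.trans e1.symm)
      obtain ⟨y, hy⟩ := card_pos.1 (show 0 < #s by omega)
      exact ⟨2, .inl rfl, (distributable₂_one_own hy (by rw [key y hy]; omega)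
        (fun z hz _ => by rw [key z hz]; omega)).distributable⟩
  · by_cases hn : ∃ y ∈ s, b y ≠ 2 ∧ ∀ z ∈ s, z ≠ y → b z ≤ 2
    · obtain ⟨y, hy, hy1, hz⟩ := hn
      exact ⟨2, .inl rfl, (distributable₂_one_own hy hy1
        fun z hzs hzy => by have := hz z hzs hzy; omega).distributable⟩
    · push Not at hn
      have key : ∀ y ∈ s, b y = 2 := by
        by_contra hcon
        push Not at hcon
        obtain ⟨y, hy, hy1⟩ := hcon
        obtain ⟨z, hz, hzy, hz3⟩ := hn y hy hy1
        obtain ⟨w, hw, hwz, hw3⟩ := hn z hz (by omega)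
        have e1 : z = x := by by_contra hne; have := hx z hz hne; omega
        have e2 : w = x := by by_contra hne; have := hx w hw hne; omega
        exact hwz (e2.trans e1.symm)
      refine ⟨3, .inr rfl, ?_⟩
      -- Two children join the parent edge. The remaining ones share class `1` unless they are just
      -- two, when the class would have the blocked size `2` and they must be separated.
      by_cases h4 : #s = 4
      · exact distributable_two_own_two_apart h4 key
      · obtain ⟨y, hy, z, hz, hyz⟩ := one_lt_card.1 (show 1 < #s by omega)
        refine (distributable₂_two_own hy hz hyz (by rw [key y hy]; omega)
          (by rw [key z hz]; omega) fun w hw => ?_).distributable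
        rw [key w hw]; omega

/-- The blocked value of a vertex one color of which must not be used. -/
lemma exists_blocked₂ (hb : ∀ y ∈ s, b y ≤ 2) :
    ∃ n ≤ 3, (∀ e, e ≠ n → ∃ q, q ≠ e ∧ Distributable₂ s b q) ∧ (n = 3 → #s = 2) ∧
      (s = ∅ → n = 1) := by
  have two : ∀ q₁ q₂, q₁ ≠ q₂ → #s ≠ 0 → Distributable₂ s b q₁ → Distributable₂ s b q₂ →
      ∃ n ≤ 3, (∀ e, e ≠ n → ∃ q, q ≠ e ∧ Distributable₂ s b q) ∧ (n = 3 → #s = 2) ∧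
      (s = ∅ → n = 1) := by
    intro q₁ q₂ hne h0 h₁ h₂
    refine ⟨0, by omega, fun e _ => ?_, by omega, fun h => by simp [h] at h0⟩
    by_cases h : q₁ = e
    · exact ⟨q₂, by omega, h₂⟩
    · exact ⟨q₁, h, h₁⟩
  obtain h | h | h | h : #s = 0 ∨ #s = 1 ∨ #s = 2 ∨ 3 ≤ #s := by omega
  · exact ⟨1, by omega, fun e he => ⟨1, he.symm, distributable₂_none_own (by simp_all)⟩,
      by omega, fun _ => rfl⟩
  · obtain ⟨y, rfl⟩ := card_eq_one.1 h
    obtain ⟨h2, h1⟩ := distributable₂_single (b := b) h (mem_singleton_self y)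
    by_cases hy1 : b y = 1
    · exact ⟨2, by omega, fun e he => ⟨2, he.symm, h2 (by omega)⟩, by omega, by simp⟩
    · by_cases hy2 : b y = 2
      · exact ⟨1, by omega, fun e he => ⟨1, he.symm, h1 hy1⟩, by omega, by simp⟩
      · exact two 1 2 (by omega) (by simp) (h1 hy1) (h2 hy2)
  -- If both children have blocked value `2`, then with two colours only the class of size `3` is
  -- possible. This is the source of the blocked value `3`.
  · have h3 : Distributable₂ s b 3 := by
      have := distributable₂_all_own (s := s) (b := b)
        (fun y hy => by have := hb y hy; omega)
      rwa [h] at this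
    exact ⟨3, by omega, fun e he => ⟨3, he.symm, h3⟩, fun _ => h, by
      rintro rfl; simp at h⟩
  · refine two 1 (#s + 1) (by omega) (by omega) (distributable₂_none_own fun y hy => ?_)
      (distributable₂_all_own fun y hy => ?_)
    all_goals have := hb y hy; omega

end


/-! ### Spanning trees of grapes -/

/-- A spanning tree of `G` rooted at `u`, given by its parent function, such that the other edges
join `u` to the vertices of `Z`. The function `top` assigns to a vertex the child of the root
below which it lies. -/
structure Frame {V : Type*} (G : SimpleGraph V) (u : V) where
  par : V → V
  ht : V → ℕ
  Z : Set V
  top : V → V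
  ht_par : ∀ x, x ≠ u → ht (par x) < ht x
  adj_iff : ∀ x y, G.Adj x y ↔ (y ≠ u ∧ par y = x) ∨ (x ≠ u ∧ par x = y) ∨
    (x = u ∧ y ∈ Z) ∨ (y = u ∧ x ∈ Z)
  ne_root : ∀ z ∈ Z, z ≠ u
  par_ne_root : ∀ z ∈ Z, par z ≠ u
  top_par : ∀ x, x ≠ u → par x ≠ u → top (par x) = top x
  top_of_par_eq : ∀ x, x ≠ u → par x = u → top x = x
  injOn_top : Set.InjOn top Z

namespace Frame

variable {V : Type*} [Fintype V] {G : SimpleGraph V} {u : V} (F : Frame G u)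

open Classical in
/-- The children of a vertex. -/
noncomputable def ch (x : V) : Finset V := {y | y ≠ u ∧ F.par y = x}

@[simp] lemma mem_ch {x y : V} : y ∈ F.ch x ↔ y ≠ u ∧ F.par y = x := by
  simp [ch]

lemma ht_lt_of_mem_ch {x y : V} (h : y ∈ F.ch x) : F.ht x < F.ht y := by
  rw [mem_ch] at h
  have := F.ht_par y h.1
  rwa [h.2] at this

/-- The subtree below `x` has a coloring with parent edge of color `o`, such that `x` is incident
to `q` edges of color `o`, all edges of the subtree are locally irregular and the edge from the
root to a vertex `z ∈ Z` has color `κ z` and is the only edge of its color at `z`. -/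
inductive Val (κ : V → Fin 3) : V → Fin 3 → ℕ → Prop
  | mk (x : V) (o : Fin 3) (A : V → Fin 3) (q : V → ℕ)
      (hx : x ∈ F.Z → κ x ≠ o ∧ ∀ y ∈ F.ch x, A y ≠ κ x)
      (hv : ∀ y ∈ F.ch x, Val κ y (A y) (q y))
      (hne : ∀ y ∈ F.ch x, q y ≠ classSize (F.ch x) A o (A y)) :
      Val κ x o (classSize (F.ch x) A o o)

/-- `Anc z x`: the vertex `x` is not the root and is `z` or an ancestor of `z`. -/
inductive Anc (z : V) : V → Prop
  | refl : Anc z z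
  | up {x : V} (h : Anc z x) (hx : F.par x ≠ u) : Anc z (F.par x)

/-- There is no vertex of `Z` below `x`. -/
def Free (x : V) : Prop := ∀ z ∈ F.Z, ¬ F.Anc z x

variable {F} {κ : V → Fin 3} {b : V → ℕ} {A : V → Fin 3} {x y z : V}

lemma Anc.ne_root (h : F.Anc z x) (hz : z ≠ u) : x ≠ u := by
  cases h <;> assumption

lemma Anc.ht_le (h : F.Anc z x) (hz : z ≠ u) : F.ht x ≤ F.ht z := by
  induction h with
  | refl => rfl
  | up h _ ih => exact (F.ht_par _ (h.ne_root hz)).le.trans ih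

lemma Anc.top_eq (h : F.Anc z x) (hz : z ≠ u) : F.top x = F.top z := by
  induction h with
  | refl => rfl
  | up h hx ih => rw [F.top_par _ (h.ne_root hz) hx, ih]

/-- Each vertex has a single parent, so the ancestors of `z` form a chain. -/
lemma Anc.total (hx : F.Anc z x) (hy : F.Anc z y) : F.Anc x y ∨ F.Anc y x := by
  induction hx with
  | refl => exact .inl hy
  | up h hu ih =>
    rcases ih with ih | ih
    · have key : ∀ {a t}, F.Anc a t → F.par a ≠ u → t = a ∨ F.Anc (F.par a) t := by
        intro a t h hu
        induction h with
        | refl => exact .inl rfl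
        | up h hu' ih =>
          rcases ih with rfl | ih
          · exact .inr .refl
          · exact .inr (ih.up hu')
      rcases key ih hu with rfl | h'
      · exact .inr (.up .refl hu)
      · exact .inl h'
    · exact .inr (ih.up hu)

/-- Heights drop strictly along the chain of ancestors of `z`, so two of its members with the same
parent coincide. -/
lemma Anc.eq_of_par_eq (hx : F.Anc z x) (hy : F.Anc z y) (hz : z ≠ u) (h : F.par x = F.par y) :
    x = y := by
  have key : ∀ {x y}, x ≠ u → y ≠ u → F.par x = F.par y → F.Anc x y → x = y := by
    intro x y hx hy h hxy
    have : ∀ {a t}, F.Anc a t → a ≠ u → t = a ∨ F.ht t ≤ F.ht (F.par a) := by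
      intro a t h ha
      induction h with
      | refl => exact .inl rfl
      | up h hu' ih =>
        rcases ih with rfl | ih
        · exact .inr le_rfl
        · exact .inr ((F.ht_par _ (h.ne_root ha)).le.trans ih)
    rcases this hxy hx with h' | h'
    · exact h'.symm
    · have := F.ht_par y hy
      rw [h] at h'; omega
  rcases hx.total hy with h' | h'
  · exact key (hx.ne_root hz) (hy.ne_root hz) h h'
  · exact (key (hy.ne_root hz) (hx.ne_root hz) h.symm h').symm

lemma Free.notMem (h : F.Free x) : x ∉ F.Z := fun hx => h x hx .refl

lemma Free.of_mem_ch (h : F.Free x) (hx : x ≠ u) (hy : y ∈ F.ch x) : F.Free y := by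
  intro z hz hzy
  rw [mem_ch] at hy
  obtain ⟨-, rfl⟩ := hy
  exact h z hz (hzy.up hx)

lemma free_of_top_ne (h : ∀ z ∈ F.Z, F.top z ≠ F.top x) : F.Free x :=
  fun z hz hzx => h z hz (hzx.top_eq (F.ne_root z hz)).symm

/-- A vertex of `Z` below `y` would have the same `top` as `z` and hence be `z`; but the chain from
`z` already enters `F.par x` through `x`. -/
lemma Anc.free_of_mem_ch (hz : z ∈ F.Z) (hx : F.Anc z x) (hu : F.par x ≠ u)
    (hy : y ∈ F.ch (F.par x)) (hyx : y ≠ x) : F.Free y := by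
  intro z' hz' hy'
  rw [mem_ch] at hy
  have hz0 := F.ne_root z hz
  have e1 := (hx.up hu).top_eq hz0
  rw [← hy.2] at hu
  have e2 := (hy'.up hu).top_eq (F.ne_root z' hz')
  rw [hy.2, e1] at e2
  obtain rfl := F.injOn_top hz hz' e2
  exact hyx (hy'.eq_of_par_eq hx hz0 hy.2)

/-- By injectivity of `top` on `Z`, the only candidate below `y` is `z` itself, which lies strictly
higher in the tree. -/
lemma free_of_mem_ch_of_mem (hz : z ∈ F.Z) (hy : y ∈ F.ch z) : F.Free y := by
  intro z' hz' hy'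
  rw [mem_ch] at hy
  have hz0 := F.ne_root z hz
  have hu : F.par y ≠ u := by rwa [hy.2]
  have e2 := (hy'.up hu).top_eq (F.ne_root z' hz')
  rw [hy.2] at e2
  obtain rfl := F.injOn_top hz hz' e2
  have := hy'.ht_le hz0
  have h3 := F.ht_par y hy.1
  rw [hy.2] at h3
  omega

lemma Anc.par_notMem (hz : z ∈ F.Z) (hx : F.Anc z x) (hu : F.par x ≠ u) : F.par x ∉ F.Z := by
  intro hm
  have hz0 := F.ne_root z hz
  have h1 := F.injOn_top hm hz ((hx.up hu).top_eq hz0)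
  have := hx.ht_le hz0
  have h3 := F.ht_par x (hx.ne_root hz0)
  rw [h1] at h3
  omega

/-! ### Values of subtrees -/

lemma classSize_perm (s : Finset V) (A : V → Fin 3) (π : Equiv.Perm (Fin 3)) (o j : Fin 3) :
    classSize s (fun y => π (A y)) (π o) (π j) = classSize s A o j := by
  simp [classSize]

/-- Distributions are normalised so that the parent edge is in class `0`; the permutation turns
classes into actual colours. The values of the children are chosen afterwards, each avoiding the
size of its class. -/
lemma val_of_perm (π : Equiv.Perm (Fin 3))
    (hZ : x ∈ F.Z → κ x ≠ π 0 ∧ ∀ y ∈ F.ch x, π (A y) ≠ κ x)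
    (hA : ∀ y ∈ F.ch x, classSize (F.ch x) A 0 (A y) ≠ b y)
    (hb : ∀ y ∈ F.ch x, ∀ e, e ≠ b y → ∃ q, q ≠ e ∧ F.Val κ y (π (A y)) q) :
    F.Val κ x (π 0) (classSize (F.ch x) A 0 0) := by
  have : ∀ y, ∃ q, y ∈ F.ch x →
      q ≠ classSize (F.ch x) A 0 (A y) ∧ F.Val κ y (π (A y)) q := by
    intro y
    by_cases hy : y ∈ F.ch x
    · obtain ⟨q, hq⟩ := hb y hy _ (hA y hy)
      exact ⟨q, fun _ => hq⟩
    · exact ⟨0, fun h => absurd h hy⟩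
  choose q hq using this
  rw [← classSize_perm (F.ch x) A π 0 0]
  refine .mk x (π 0) (fun y => π (A y)) q hZ (fun y hy => (hq y hy).2) fun y hy => ?_
  rw [classSize_perm]
  exact (hq y hy).1

variable (F) in
/-- The vertex `x` may be put into any class whose size is not `n`. -/
def Blocks (x : V) (n : ℕ) : Prop :=
  ∀ κ o e, e ≠ n → ∃ q, q ≠ e ∧ F.Val κ x o q

variable (F) in
/-- As `Blocks`, for an ancestor of `z ∈ Z` and parent edges not colored as the edge `uz`. -/
def BlocksOn (z x : V) (n : ℕ) : Prop :=
  ∀ κ o e, o ≠ κ z → e ≠ n → ∃ q, q ≠ e ∧ F.Val κ x o q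

lemma Free.val_of_distributable {q : ℕ} (hx : F.Free x)
    (hb : ∀ y ∈ F.ch x, F.Blocks y (b y)) (h : Distributable (F.ch x) b q) (κ : V → Fin 3)
    (o : Fin 3) : F.Val κ x o q := by
  obtain ⟨A, hA, rfl⟩ := h
  have := val_of_perm (F := F) (κ := κ) (x := x) (Equiv.swap 0 o) (fun h => absurd h hx.notMem) hA
    fun y hy e he => hb y hy _ _ e he
  simpa using this

/-- `exists_blocked` carries the bound `2` from the children to their parent, so it propagates up
from the leaves. -/
lemma Free.exists_blocks (hx : F.Free x) (hxu : x ≠ u) : ∃ n ≤ 2, F.Blocks x n := by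
  -- Heights grow away from the root, so the induction runs on the distance of the height to an
  -- upper bound.
  obtain ⟨N, hN⟩ : ∃ N, ∀ y, F.ht y ≤ N :=
    ⟨univ.sup F.ht, fun y => le_sup (f := F.ht) (mem_univ y)⟩
  induction hm : N - F.ht x using Nat.strong_induction_on generalizing x with
  | _ m ih =>
    have : ∀ y, ∃ n, y ∈ F.ch x → n ≤ 2 ∧ F.Blocks y n := by
      intro y
      by_cases hy : y ∈ F.ch x
      · have h1 := F.ht_lt_of_mem_ch hy
        have h2 := hN y
        obtain ⟨n, hn⟩ := ih (N - F.ht y) (by omega) (hx.of_mem_ch hxu hy)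
          (F.mem_ch.1 hy).1 rfl
        exact ⟨n, fun _ => hn⟩
      · exact ⟨0, fun h => absurd h hy⟩
    choose b hb using this
    obtain ⟨n, hn, h, -⟩ := exists_blocked (s := F.ch x) (b := b) x
      (fun y hy => (hb y hy).1.trans (by omega)) (fun y hy _ => (hb y hy).1)
    refine ⟨n, hn, fun κ o e he => ?_⟩
    obtain ⟨q, hq, hd⟩ := h e he
    exact ⟨q, hq, hx.val_of_distributable (fun y hy => (hb y hy).2) hd κ o⟩

variable (F) in
lemma exists_blocks_free : ∃ b : V → ℕ, ∀ x, F.Free x → x ≠ u → b x ≤ 2 ∧ F.Blocks x (b x) := by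
  have : ∀ x, ∃ n, F.Free x → x ≠ u → n ≤ 2 ∧ F.Blocks x n := by
    intro x
    by_cases h : F.Free x ∧ x ≠ u
    · obtain ⟨n, hn⟩ := h.1.exists_blocks h.2
      exact ⟨n, fun _ _ => hn⟩
    · exact ⟨0, fun h1 h2 => absurd ⟨h1, h2⟩ h⟩
  choose b hb using this
  exact ⟨b, hb⟩

/-- Free subtrees have a value at most `2`. -/
lemma Free.exists_val_le_two (hx : F.Free x) (hxu : x ≠ u) :
    ∃ q, (q = 1 ∨ q = 2) ∧ ∀ κ o, F.Val κ x o q := by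
  obtain ⟨b, hb⟩ := F.exists_blocks_free
  have hb' : ∀ y ∈ F.ch x, b y ≤ 2 ∧ F.Blocks y (b y) := fun y hy =>
    hb y (hx.of_mem_ch hxu hy) (F.mem_ch.1 hy).1
  obtain ⟨q, hq, h⟩ := exists_distributable_le_two fun y hy => (hb' y hy).1
  exact ⟨q, hq, hx.val_of_distributable (fun y hy => (hb' y hy).2) h⟩

/-- Both children join the parent edge, as neither blocks size `3`. This makes all edges at the
neighbour of the root in a `B₇` equal in colour. -/
lemma Free.val_three (hx : F.Free x) (hxu : x ≠ u) (hc : #(F.ch x) = 2) (κ : V → Fin 3)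
    (o : Fin 3) : F.Val κ x o 3 := by
  obtain ⟨b, hb⟩ := F.exists_blocks_free
  have hb' : ∀ y ∈ F.ch x, b y ≤ 2 ∧ F.Blocks y (b y) := fun y hy =>
    hb y (hx.of_mem_ch hxu hy) (F.mem_ch.1 hy).1
  have := distributable₂_all_own (s := F.ch x) (b := b)
    (fun y hy => by have := (hb' y hy).1; omega)
  rw [hc] at this
  exact hx.val_of_distributable (fun y hy => (hb' y hy).2) this.distributable κ o

/-- Used to keep the colour `κ z` off the edge that leads down towards `z`. -/
lemma exists_perm_avoiding : ∀ o c i : Fin 3, o ≠ c →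
    ∃ π : Equiv.Perm (Fin 3), π 0 = o ∧ π i ≠ c := by
  decide

/-- Used at `z` itself, where the empty class `2` is turned into the colour `κ z`. -/
lemma exists_perm_of_ne : ∀ o c : Fin 3, o ≠ c →
    ∃ π : Equiv.Perm (Fin 3), π 0 = o ∧ π 2 = c := by
  decide

/-- The path child `x` is the only child whose colour is restricted: `BlocksOn` requires its edge to
differ from `κ z`, and the renaming is chosen accordingly. All other children accept every colour.
-/
lemma Anc.val_of_distributable {q : ℕ} (hz : z ∈ F.Z) (hx : F.Anc z x) (hu : F.par x ≠ u)
    (hb : ∀ y ∈ F.ch (F.par x), y ≠ x → F.Blocks y (b y)) (hbx : F.BlocksOn z x (b x))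
    (h : Distributable (F.ch (F.par x)) b q) (κ : V → Fin 3) (o : Fin 3) (ho : o ≠ κ z) :
    F.Val κ (F.par x) o q := by
  obtain ⟨A, hA, rfl⟩ := h
  obtain ⟨π, rfl, hπ⟩ := exists_perm_avoiding o (κ z) (A x) ho
  refine val_of_perm π (fun h => absurd h (hx.par_notMem hz hu)) hA fun y hy e he => ?_
  by_cases hyx : y = x
  · subst hyx
    exact hbx _ _ e hπ he
  · exact hb y hy hyx _ _ e he

/-- The blocked value of a vertex of `Z`. -/
lemma exists_blocksOn_self (hz : z ∈ F.Z) :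
    ∃ n ≤ 3, F.BlocksOn z z n ∧ (n = 3 → #(F.ch z) = 2) ∧ (F.ch z = ∅ → n = 1) := by
  obtain ⟨b, hb⟩ := F.exists_blocks_free
  have hb' : ∀ y ∈ F.ch z, b y ≤ 2 ∧ F.Blocks y (b y) := fun y hy =>
    hb y (free_of_mem_ch_of_mem hz hy) (F.mem_ch.1 hy).1
  obtain ⟨n, hn, h, h3, h1⟩ := exists_blocked₂ fun y hy => (hb' y hy).1
  refine ⟨n, hn, fun κ o e ho he => ?_, h3, h1⟩
  obtain ⟨q, hq, A, hA2, hA, rfl⟩ := h e he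
  obtain ⟨π, rfl, hπ⟩ := exists_perm_of_ne o (κ z) ho
  refine ⟨_, hq, val_of_perm π (fun _ => ⟨ho.symm, fun y hy => ?_⟩) hA
    fun y hy e he => (hb' y hy).2 _ _ e he⟩
  rw [← hπ]
  exact π.injective.ne (hA2 y hy)

/-- Prescribes the blocked value of the path child and combines it with those of its free siblings.
-/
lemma Anc.exists_blocks_children (hz : z ∈ F.Z) (hx : F.Anc z x) (hu : F.par x ≠ u) {n : ℕ}
    (hn : F.BlocksOn z x n) : ∃ b : V → ℕ, b x = n ∧
    (∀ y ∈ F.ch (F.par x), y ≠ x → b y ≤ 2 ∧ F.Blocks y (b y)) ∧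
    ∀ q, Distributable (F.ch (F.par x)) b q → ∀ κ o, o ≠ κ z → F.Val κ (F.par x) o q := by
  classical
  obtain ⟨b, hb⟩ := F.exists_blocks_free
  have hb' : ∀ y ∈ F.ch (F.par x), y ≠ x → Function.update b x n y ≤ 2 ∧
      F.Blocks y (Function.update b x n y) := by
    intro y hy hyx
    rw [Function.update_of_ne hyx]
    exact hb y (hx.free_of_mem_ch hz hu hy hyx) (F.mem_ch.1 hy).1
  refine ⟨Function.update b x n, by simp, hb', fun q h κ o ho => ?_⟩
  exact hx.val_of_distributable hz hu (fun y hy hyx => (hb' y hy hyx).2) (by simpa) h κ o ho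

/-- The blocked values of the ancestors of a vertex of `Z`. -/
lemma Anc.exists_blocksOn (hz : z ∈ F.Z) (hx : F.Anc z x) :
    ∃ n ≤ 3, F.BlocksOn z x n ∧ (n = 3 → x = z ∧ #(F.ch z) = 2) ∧
      (x = z → F.ch z = ∅ → n = 1) ∧
      (n = 1 → x = z ∨ ∃ y, F.ch x = {y} ∧ F.BlocksOn z y 2) := by
  induction hx with
  | refl =>
    obtain ⟨n, hn, h, h3, h1⟩ := exists_blocksOn_self hz
    exact ⟨n, hn, h, fun h => ⟨rfl, h3 h⟩, fun _ => h1, fun _ => .inl rfl⟩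
  | @up x hx hu ih =>
    obtain ⟨m, hm, h, -⟩ := ih
    have hz0 := F.ne_root z hz
    have hmem : x ∈ F.ch (F.par x) := by simp [hx.ne_root hz0]
    obtain ⟨b, rfl, hb, hd⟩ := hx.exists_blocks_children hz hu h
    obtain ⟨n, hn, hq, h1⟩ := exists_blocked (s := F.ch (F.par x)) (b := b) x
      (fun y hy => by
        by_cases hyx : y = x
        · rwa [hyx]
        · exact (hb y hy hyx).1.trans (by omega))
      (fun y hy hyx => (hb y hy hyx).1)
    refine ⟨n, by omega, fun κ o e ho he => ?_, by omega, fun he => ?_, fun he => .inr ?_⟩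
    · obtain ⟨q, hq, hq'⟩ := hq e he
      exact ⟨q, hq, hd q hq' κ o ho⟩
    · exact absurd hz (he ▸ hx.par_notMem hz hu)
    · rcases h1 he with h0 | ⟨y, hy, hy2⟩
      · simp [h0] at hmem
      · have : x = y := by rw [hy] at hmem; simpa using hmem
        subst this
        rw [hy2] at h
        exact ⟨x, hy, h⟩

/-- The path from `z ∈ Z` to the root arrives at the child of the root through some vertex. -/
lemma exists_anc_par_eq_top (hz : z ∈ F.Z) :
    ∃ x, F.Anc z x ∧ F.par x ≠ u ∧ F.par x = F.top z ∧ F.par (F.par x) = u := by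
  have hz0 := F.ne_root z hz
  have : ∀ n x, F.ht x = n → F.Anc z x → F.par x ≠ u →
      ∃ x, F.Anc z x ∧ F.par x ≠ u ∧ F.par (F.par x) = u := by
    intro n
    induction n using Nat.strong_induction_on with
    | _ n ih =>
      intro x hn hx hu
      by_cases h : F.par (F.par x) = u
      · exact ⟨x, hx, hu, h⟩
      · exact ih _ (hn ▸ F.ht_par x (hx.ne_root hz0)) _ rfl (hx.up hu) h
  obtain ⟨x, hx, hu, h⟩ := this _ z rfl .refl (F.par_ne_root z hz)
  refine ⟨x, hx, hu, ?_, h⟩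
  rw [← (hx.up hu).top_eq hz0, F.top_of_par_eq _ hu h]

lemma top_ne_root (hz : z ∈ F.Z) : F.top z ≠ u := by
  obtain ⟨x, -, hu, h, -⟩ := exists_anc_par_eq_top hz
  rwa [← h]

lemma par_top (hz : z ∈ F.Z) : F.par (F.top z) = u := by
  obtain ⟨x, -, hu, h, h'⟩ := exists_anc_par_eq_top hz
  rwa [← h]

/-- Cycles through the root whose vertices next to the root have further branches. -/
lemma exists_val_of_two_le (hz : z ∈ F.Z) (h2 : 2 ≤ #(F.ch (F.top z)))
    (hbal : #(F.ch z) + 1 ≤ #(F.ch (F.top z))) :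
    (∃ q, (q = 2 ∨ q = 3) ∧ ∀ κ o, o ≠ κ z → F.Val κ (F.top z) o q) ∧
    ∃ q, 3 ≤ q ∧ ∀ κ o, o ≠ κ z → F.Val κ (F.top z) o q := by
  obtain ⟨x, hx, hu, h, -⟩ := exists_anc_par_eq_top hz
  rw [← h] at h2 hbal ⊢
  obtain ⟨n, hn, hb, h3, -⟩ := hx.exists_blocksOn hz
  obtain ⟨b, rfl, hb', hd⟩ := hx.exists_blocks_children hz hu hb
  refine ⟨?_, #(F.ch (F.par x)) + 1, by omega,
    hd _ (distributable₂_all_own fun y hy => ?_).distributable⟩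
  -- A blocked value `3` forces `x = z` and two children at `z`; by `hbal` the top vertex then has
  -- at least three.
  · have hle : #(F.ch (F.par x)) = 2 → ∀ y ∈ F.ch (F.par x), b y ≤ 2 := by
      intro hc y hy
      by_cases hyx : y = x
      · subst hyx; omega
      · exact (hb' y hy hyx).1
    obtain ⟨q, hq, h'⟩ := exists_distributable_two_or_three x h2
      (fun y hy hyx => (hb' y hy hyx).1) hle
    exact ⟨q, hq, hd q h'⟩
  · by_cases hyx : y = x
    · subst hyx; omega
    · have := (hb' y hy hyx).1; omega

/-- Triangles. -/
lemma exists_val_of_triangle (hz : z ∈ F.Z) (h0 : F.ch z = ∅) (h1 : #(F.ch (F.top z)) = 1)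
    (hp : F.par z = F.top z) : ∀ κ o, o ≠ κ z → F.Val κ (F.top z) o 2 := by
  have hz0 := F.ne_root z hz
  have hu := F.par_ne_root z hz
  obtain ⟨n, hn, hb, -, hn1⟩ := exists_blocksOn_self hz
  obtain rfl := hn1 h0
  obtain ⟨b, hb1, hb', hd⟩ := Anc.refl.exists_blocks_children hz hu hb
  rw [← hp] at h1 ⊢
  have hmem : z ∈ F.ch (F.par z) := by simp [hz0]
  exact hd 2 ((distributable₂_single h1 hmem).1 (by omega)).distributable

lemma exists_ne_color : ∀ c : Fin 3, ∃ a, a ≠ c := by decide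

/-- At a vertex with one child, the child edge has a class of size `2` or `1` according to whether
it shares the colour of the parent edge. -/
lemma val_of_single {o c : Fin 3} {n : ℕ} (hx : x ∉ F.Z) (hc : F.ch x = {y})
    (hy : ∃ q, q ≠ n ∧ F.Val κ y c q) (hn : n = if o = c then 2 else 1) :
    F.Val κ x o (if o = c then 2 else 1) := by
  obtain ⟨q, hq, hv⟩ := hy
  have hs : ∀ j, classSize (F.ch x) (fun _ => c) o j =
      (if o = j then 1 else 0) + if c = j then 1 else 0 := by
    intro j
    rw [classSize, hc]
    by_cases h : c = j <;> simp [h]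
  have := Val.mk (F := F) (κ := κ) x o (fun _ => c) (fun _ => q) (fun h => absurd h hx)
    (by rw [hc]; simpa using hv) (by
      intro w hw
      rw [hs]
      by_cases h : o = c <;> simp_all)
  rw [hs] at this
  by_cases h : o = c
  · simp_all
  · simp_all [Ne.symm h]

/-- Cycles through the root without branches next to the root which are not triangles. -/
lemma exists_val_of_long (hz : z ∈ F.Z) (h0 : F.ch z = ∅) (h1 : #(F.ch (F.top z)) = 1)
    (hp : F.par z ≠ F.top z) :
    ∃ q, (q = 1 ∨ q = 2) ∧ ∀ κ, F.Val κ (F.top z) (κ z) q := by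
  have hz0 := F.ne_root z hz
  obtain ⟨x, hx, hu, h, -⟩ := exists_anc_par_eq_top hz
  rw [← h] at h1 hp ⊢
  have hmem : x ∈ F.ch (F.par x) := by simp [hx.ne_root hz0]
  have hch : F.ch (F.par x) = {x} := by
    obtain ⟨y, hy⟩ := card_eq_one.1 h1
    rw [hy] at hmem ⊢
    rw [mem_singleton.1 hmem]
  have hxz : x ≠ z := by rintro rfl; exact hp rfl
  have hxZ : x ∉ F.Z := by
    intro hm
    exact hxz (F.injOn_top hm hz (hx.top_eq hz0))
  obtain ⟨n, hn, hb, -, -, hn1⟩ := hx.exists_blocksOn hz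
  -- The root edge is to receive the colour `κ z` itself. If `x` does not block `1`, the edge from
  -- the top vertex to `x` takes another colour. Otherwise it also takes `κ z`, and the colour
  -- changes one edge lower: `x` has value `1`, the top vertex `2`, and the only child of `x` blocks
  -- `2` rather than `1`.
  by_cases hn' : n = 1
  · obtain hcon | ⟨y, hy, hb2⟩ := hn1 hn'
    · exact absurd hcon hxz
    refine ⟨2, .inr rfl, fun κ => ?_⟩
    obtain ⟨a, ha⟩ := exists_ne_color (κ z)
    have hvx := val_of_single (κ := κ) (o := κ z) hxZ hy (hb2 κ a 1 ha (by omega))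
      (by simp [ha.symm])
    rw [if_neg ha.symm] at hvx
    have := val_of_single (κ := κ) (o := κ z) (c := κ z) (hx.par_notMem hz hu) hch
      ⟨1, (by omega : (1 : ℕ) ≠ 2), hvx⟩ (by simp)
    simpa using this
  · refine ⟨1, .inl rfl, fun κ => ?_⟩
    obtain ⟨a, ha⟩ := exists_ne_color (κ z)
    have := val_of_single (κ := κ) (o := κ z) (hx.par_notMem hz hu) hch
      (hb κ a 1 ha (by omega)) (by simp [ha.symm])
    rwa [if_neg ha.symm] at this

end Frame


/-! ### Coloring the edges at the root -/

section
variable {V : Type*} [DecidableEq V]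

/-- The size of the class of color `j` at the root, where `B ∪ S` are the children of the root on
cycles, `T` are the other children, `wc` gives the colors of the edges to the children and `zc`
those of the second edges of the cycles. -/
def rootSize (B S T : Finset V) (wc zc : V → Fin 3) (j : Fin 3) : ℕ :=
  #{y ∈ B ∪ S ∪ T | wc y = j} + #{y ∈ B ∪ S | zc y = j}

variable {B S T : Finset V}

/-- All edges to berries outside `B` get colour `0`: two for each member of `S`, one for each member
of `T`. -/
lemma rootSize_ite (hBS : Disjoint B S) (hBT : Disjoint B T) (hST : Disjoint S T)
    (w z : V → Fin 3) (j : Fin 3) :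
    rootSize B S T (fun y => if y ∈ B then w y else 0) (fun y => if y ∈ B then z y else 0) j =
      #{y ∈ B | w y = j} + #{y ∈ B | z y = j} + if j = 0 then 2 * #S + #T else 0 := by
  have hB : ∀ f : V → Fin 3, ({y ∈ B | (if y ∈ B then f y else 0) = j} : Finset V) =
      ({y ∈ B | f y = j} : Finset V) := fun f => filter_congr fun y hy => by simp [hy]
  have hO : ∀ (f : V → Fin 3) (U : Finset V), Disjoint B U →
      #{y ∈ U | (if y ∈ B then f y else 0) = j} = if j = 0 then #U else 0 := by
    intro f U hU
    have : ({y ∈ U | (if y ∈ B then f y else 0) = j} : Finset V) = ({y ∈ U | 0 = j} : Finset V) :=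
      filter_congr fun y hy => by simp [disjoint_right.1 hU hy]
    rw [this]
    by_cases h : j = 0
    · simp [h]
    · simp [h, Ne.symm h]
  have hd : Disjoint (B ∪ S) T := disjoint_union_left.2 ⟨hBT, hST⟩
  rw [rootSize, filter_union, card_union_of_disjoint (disjoint_filter_filter hd),
    filter_union, card_union_of_disjoint (disjoint_filter_filter hBS),
    filter_union, card_union_of_disjoint (disjoint_filter_filter hBS), hB, hB, hO _ _ hBS,
    hO _ _ hBS, hO _ _ hBT]
  split_ifs <;> omega

/-- An admissible coloring of the edges at the root; `q` are the degrees of the children in `B`, in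
the colors of their edges to the root, and the children in `X ∩ T` have degree `3`. -/
def IsRootColoring (B S T : Finset V) (X : V → Prop) (q : V → ℕ) (wc zc : V → Fin 3) : Prop :=
  (∀ y ∈ S, wc y = zc y ∧ 3 ≤ rootSize B S T wc zc (wc y)) ∧
  (∀ y ∈ B, wc y ≠ zc y ∧ rootSize B S T wc zc (wc y) ≠ q y ∧
    2 ≤ rootSize B S T wc zc (zc y)) ∧
  (∀ y ∈ T, (¬ X y → 3 ≤ rootSize B S T wc zc (wc y)) ∧
    (X y → rootSize B S T wc zc (wc y) ≠ 3))

/-- Reduces the choice of root colours to the edges of the cycles in `B`, with `D` tabulating the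
class sizes. -/
lemma isRootColoring_ite (hBS : Disjoint B S) (hBT : Disjoint B T) (hST : Disjoint S T)
    {X : V → Prop} {q : V → ℕ} (w z : V → Fin 3) (D : Fin 3 → ℕ)
    (hD : ∀ j, D j = #{y ∈ B | w y = j} + #{y ∈ B | z y = j} + if j = 0 then 2 * #S + #T else 0)
    (hS : S.Nonempty → 3 ≤ D 0) (hT : T.Nonempty → 3 ≤ D 0)
    (hX : (∃ y ∈ T, X y) → D 0 ≠ 3)
    (hB : ∀ y ∈ B, w y ≠ z y ∧ D (w y) ≠ q y ∧ 2 ≤ D (z y)) :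
    ∃ wc zc, IsRootColoring B S T X q wc zc := by
  refine ⟨fun y => if y ∈ B then w y else 0, fun y => if y ∈ B then z y else 0, ?_, ?_, ?_⟩
  all_goals simp only [rootSize_ite hBS hBT hST, ← hD]
  · intro y hy
    simp only [disjoint_right.1 hBS hy, if_false, true_and]
    exact hS ⟨y, hy⟩
  · intro y hy
    simp only [hy, if_true]
    exact hB y hy
  · intro y hy
    simp only [disjoint_right.1 hBT hy, if_false]
    exact ⟨fun _ => hT ⟨y, hy⟩, fun h => hX ⟨y, hy, h⟩⟩

/-- The case where giving all three first edges the same colour fails, because a class of size `3`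
meets a child of value `3`. -/
lemma exists_isRootColoring_three (hBS : Disjoint B S) (hBT : Disjoint B T) (hST : Disjoint S T)
    {X : V → Prop} {q : V → ℕ} {i j l : V} (hij : i ≠ j) (hil : i ≠ l) (hjl : j ≠ l)
    (hB : B = {i, j, l}) (hqi : q i = 3) (hqj : q j = 2 ∨ q j = 3)
    (hql : if q j = 3 then 2 ≤ q l else q l = 2) :
    ∃ wc zc, IsRootColoring B S T X q wc zc := by
  have hTX : (∃ y ∈ T, X y) → 1 ≤ #T := fun ⟨y, hy, _⟩ => card_pos.2 ⟨y, hy⟩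
  have hS0 : S.Nonempty → 1 ≤ #S := fun h => card_pos.2 h
  have hT0 : T.Nonempty → 1 ≤ #T := fun h => card_pos.2 h
  rcases hqj with hqj | hqj
  -- Values `3, 2, 2`: the first edges at `i`, `j`, `l` have colours `1`, `2`, `0`, the second ones
  -- `0`, `0`, `1`. The classes have sizes at least `3`, exactly `2` and exactly `1`.
  · refine isRootColoring_ite hBS hBT hST (fun y => if y = i then 1 else if y = j then 2 else 0)
      (fun y => if y = l then 1 else 0)
      (fun j => if j = 0 then 3 + (2 * #S + #T) else if j = 1 then 2 else 1) ?_ ?_ ?_ ?_ ?_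
    · subst hB
      intro c
      fin_cases c <;> simp [filter_insert, filter_singleton, hij, hil, hjl, hij.symm, hil.symm,
        hjl.symm]
    · intro h; have := hS0 h; simp only [if_true]; omega
    · intro h; have := hT0 h; simp only [if_true]; omega
    · intro h; have := hTX h; simp only [if_true]; omega
    · subst hB
      simp [hij, hil, hjl, hij.symm, hil.symm, hjl.symm, hqi, hqj] at hql ⊢
      omega
  -- Two values `3`: `i` and `j` share a class of size `2`, while `l` is alone.
  · refine isRootColoring_ite hBS hBT hST (fun y => if y = l then 2 else 1)
      (fun y => 0)
      (fun j => if j = 0 then 3 + (2 * #S + #T) else if j = 1 then 2 else 1) ?_ ?_ ?_ ?_ ?_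
    · subst hB
      intro c
      fin_cases c <;> simp [filter_insert, filter_singleton, hij, hil, hjl, hij.symm, hil.symm,
        hjl.symm]
    · intro h; have := hS0 h; simp only [if_true]; omega
    · intro h; have := hT0 h; simp only [if_true]; omega
    · intro h; have := hTX h; simp only [if_true]; omega
    · subst hB
      simp [hij, hil, hjl, hij.symm, hil.symm, hjl.symm, hqi, hqj] at hql ⊢
      omega

/-- All first edges form class `1`, of size `#B`; all second edges and the other berries form class
`0`. -/
lemma exists_isRootColoring_uniform (hBS : Disjoint B S) (hBT : Disjoint B T)
    (hST : Disjoint S T) (h2 : 2 ≤ #B + #S) {X : V → Prop} {q : V → ℕ}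
    (hq : ∀ y ∈ B, #B ≠ q y) (hB : #B ≠ 2) :
    ∃ wc zc, IsRootColoring B S T X q wc zc := by
  have hTX : (∃ y ∈ T, X y) → 1 ≤ #T := fun ⟨y, hy, _⟩ => card_pos.2 ⟨y, hy⟩
  have hS0 : S.Nonempty → 1 ≤ #S := fun h => card_pos.2 h
  have hT0 : T.Nonempty → 1 ≤ #T := fun h => card_pos.2 h
  refine isRootColoring_ite hBS hBT hST (fun y => 1) (fun y => 0)
    (fun j => if j = 0 then #B + (2 * #S + #T) else if j = 1 then #B else 0) ?_ ?_ ?_ ?_ ?_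
  · intro c
    fin_cases c <;> simp
  · intro h; have := hS0 h; simp only [if_true]; omega
  · intro h; have := hT0 h; simp only [if_true]; omega
  · intro h; have := hTX h; simp only [if_true]; omega
  · intro y hy
    simpa using ⟨hq y hy, by omega⟩

/-- The first edges are alone in classes `1` and `2`, below every value. Class `0` has size `2 + 2 *
#S + #T`, which is `3` only in the excluded case. -/
lemma exists_isRootColoring_two (hBS : Disjoint B S) (hBT : Disjoint B T)
    (hST : Disjoint S T) {X : V → Prop} {q : V → ℕ}
    (hq : ∀ y ∈ B, 2 ≤ q y) (hB : #B = 2) (hX : S = ∅ → #T = 1 → ∀ y ∈ T, ¬ X y) :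
    ∃ wc zc, IsRootColoring B S T X q wc zc := by
  have hS0 : S.Nonempty → 1 ≤ #S := fun h => card_pos.2 h
  have hT0 : T.Nonempty → 1 ≤ #T := fun h => card_pos.2 h
  obtain ⟨i, j, hij, rfl⟩ := card_eq_two.1 hB
  refine isRootColoring_ite hBS hBT hST (fun y => if y = i then 1 else 2) (fun y => 0)
    (fun j => if j = 0 then 2 + (2 * #S + #T) else 1) ?_ ?_ ?_ ?_ ?_
  · intro c
    fin_cases c <;> simp [filter_insert, filter_singleton, hij, hij.symm]
  · intro h; have := hS0 h; simp only [if_true]; omega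
  · intro h; have := hT0 h; simp only [if_true]; omega
  · rintro ⟨y, hy, hXy⟩ h
    have := card_pos.2 ⟨y, hy⟩
    simp at h
    exact hX (card_eq_zero.1 (by omega)) (by omega) y hy hXy
  · simp [hij.symm]
    have := hq i (by simp)
    have := hq j (by simp)
    omega

lemma exists_isRootColoring (hBS : Disjoint B S) (hBT : Disjoint B T) (hST : Disjoint S T)
    (h2 : 2 ≤ #B + #S) {X : V → Prop} {q : V → ℕ} (hq : ∀ y ∈ B, q y = 2 ∨ q y = 3)
    (hX : #B = 2 → S = ∅ → #T = 1 → ∀ y ∈ T, ¬ X y) :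
    ∃ wc zc, IsRootColoring B S T X q wc zc := by
  by_cases hB2 : #B = 2
  · exact exists_isRootColoring_two hBS hBT hST (fun y hy => by have := hq y hy; omega) hB2 (hX hB2)
  by_cases hB : ∀ y ∈ B, #B ≠ q y
  · exact exists_isRootColoring_uniform hBS hBT hST h2 hB hB2
  push Not at hB
  obtain ⟨y, hy, hBy⟩ := hB
  have hB3 : #B = 3 := by have := hq y hy; omega
  obtain ⟨a, b, c, hab, hac, hbc, h⟩ := card_eq_three.1 hB3
  have ha := hq a (by simp [h])
  have hb := hq b (by simp [h])
  have hc := hq c (by simp [h])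
  have hsome : q a = 3 ∨ q b = 3 ∨ q c = 3 := by
    simp only [h, mem_insert, mem_singleton] at hy
    rcases hy with rfl | rfl | rfl <;> omega
  have e1 : B = {a, c, b} := by rw [h, pair_comm b c]
  have e2 : B = {b, a, c} := by rw [h, insert_comm]
  have e3 : B = {b, c, a} := by rw [h, insert_comm, pair_comm a c]
  have e4 : B = {c, a, b} := by rw [h, pair_comm b c, insert_comm]
  have three := fun (i j l : V) => exists_isRootColoring_three (X := X) (q := q) (i := i) (j := j)
    (l := l) hBS hBT hST
  rcases ha with ha | ha
  · rcases hb with hb | hb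
    · exact three c a b hac.symm hbc.symm hab e4 (by omega) (by omega) (by simp [ha, hb])
    · rcases hc with hc | hc
      · exact three b a c hab.symm hbc hac e2 hb (by omega) (by simp [ha, hc])
      · exact three b c a hbc hab.symm hac.symm e3 hb (by omega) (by simp [ha, hc])
  · rcases hb with hb | hb
    · rcases hc with hc | hc
      · exact three a b c hab hac hbc h ha (by omega) (by simp [hb, hc])
      · exact three a c b hac hab hbc.symm e1 ha (by omega) (by simp [hb, hc])
    · exact three a b c hab hac hbc h ha (by omega) (by simp only [hb, if_true]; omega)

/-- The `B₇` edge shares class `1` with the first edge at `i`. That class has size `2`, harmless for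
two values of at least `3`; `j` is alone, and the two second edges form class `0`. -/
lemma exists_isRootColoring_special (hBT : Disjoint B T) {X : V → Prop} {q : V → ℕ} {i : V}
    (hB : #B = 2) (hT : #T = 1) (hq : ∀ y ∈ B, 2 ≤ q y) (hi : i ∈ B) (hqi : 3 ≤ q i)
    (hX : ∀ y ∈ T, X y) :
    ∃ wc zc, IsRootColoring B ∅ T X q wc zc := by
  obtain ⟨t, rfl⟩ := card_eq_one.1 hT
  obtain ⟨j, hij, rfl⟩ : ∃ j, i ≠ j ∧ B = {i, j} := by
    obtain ⟨a, b, hab, rfl⟩ := card_eq_two.1 hB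
    simp at hi
    rcases hi with rfl | rfl
    · exact ⟨b, hab, rfl⟩
    · exact ⟨a, hab.symm, pair_comm _ _⟩
  have hti : t ≠ i := by rintro rfl; simp at hBT
  have htj : t ≠ j := by rintro rfl; simp at hBT
  have hD : ∀ c, rootSize {i, j} ∅ {t} (fun y => if y = j then 2 else 1) (fun _ => 0) c =
      if c = 2 then 1 else 2 := by
    intro c
    rw [rootSize]
    fin_cases c <;>
      simp [filter_insert, filter_singleton, filter_union, hij, hij.symm, hti, htj, hti.symm,
        htj.symm]
  refine ⟨fun y => if y = j then 2 else 1, fun _ => 0, by simp, ?_, ?_⟩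
  all_goals simp only [hD]
  · have := hq j (by simp)
    simp [hij]
    omega
  · have := hX t (by simp)
    simp [htj, this]

end


/-! ### Combining the values of the subtrees at the root -/

namespace Frame

variable {V : Type*} [Fintype V] {G : SimpleGraph V} {u : V} (F : Frame G u)

open Classical in
/-- The set `Z` as a finset. -/
noncomputable def zs : Finset V := {z | z ∈ F.Z}

@[simp] lemma mem_zs {z : V} : z ∈ F.zs ↔ z ∈ F.Z := by simp [zs]

/-- The size of the class of color `j` at the root. -/
noncomputable def rootDeg (κ A : V → Fin 3) (j : Fin 3) : ℕ :=
  #{y ∈ F.ch u | A y = j} + #{z ∈ F.zs | κ z = j}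

/-- The cycle through `uz` is not a triangle and has no branch at the child of the root. -/
def Long (z : V) : Prop := #(F.ch (F.top z)) = 1 ∧ F.par z ≠ F.top z

variable {F}

lemma top_mem_ch {z : V} (hz : z ∈ F.Z) : F.top z ∈ F.ch u := by
  simp [top_ne_root hz, par_top hz]

lemma one_le_card_ch_top {z : V} (hz : z ∈ F.Z) : 1 ≤ #(F.ch (F.top z)) := by
  obtain ⟨x, hx, hu, h, -⟩ := exists_anc_par_eq_top hz
  exact card_pos.2 ⟨x, by simp [hx.ne_root (F.ne_root z hz), h]⟩

/-- Colors of the edges at the root, and the values of the subtrees below the root. -/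
theorem exists_root_coloring (hbal : ∀ z ∈ F.Z, #(F.ch z) + 1 ≤ #(F.ch (F.top z)))
    (hZ : 2 ≤ #F.zs) (X : V → Prop)
    (hXc : ∀ y ∈ F.ch u, X y → (∀ z ∈ F.Z, F.top z ≠ y) → #(F.ch y) = 2)
    (hX : #F.zs = 2 → #(F.ch u) = 3 → (∃ y ∈ F.ch u, X y ∧ ∀ z ∈ F.Z, F.top z ≠ y) →
      ∃ z ∈ F.Z, 2 ≤ #(F.ch (F.top z)) ∨ F.Long z) :
    ∃ (κ A : V → Fin 3) (q : V → ℕ), (∀ y ∈ F.ch u, F.Val κ y (A y) (q y)) ∧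
      (∀ y ∈ F.ch u, q y ≠ F.rootDeg κ A (A y)) ∧ (∀ z ∈ F.Z, 2 ≤ F.rootDeg κ A (κ z)) ∧
      (∀ z ∈ F.Z, (F.Long z ∧ κ z = A (F.top z) ∧ q (F.top z) ≤ 2) ∨
        (κ z ≠ A (F.top z) ∧ 2 ≤ q (F.top z))) ∧
      (∀ y ∈ F.ch u, (∀ z ∈ F.Z, F.top z ≠ y) → (¬ X y → q y ≤ 2) ∧ (X y → q y = 3)) := by
  classical
  set S : Finset V := ({z ∈ F.zs | F.Long z}).image F.top with hS
  set B : Finset V := ({z ∈ F.zs | ¬ F.Long z}).image F.top with hB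
  set T : Finset V := F.ch u \ (B ∪ S) with hT
  have mS : ∀ {y}, y ∈ S ↔ ∃ z ∈ F.Z, F.Long z ∧ F.top z = y := by
    intro y; simp [hS, and_assoc]
  have mB : ∀ {y}, y ∈ B ↔ ∃ z ∈ F.Z, ¬ F.Long z ∧ F.top z = y := by
    intro y; simp [hB, and_assoc]
  have mT : ∀ {y}, y ∈ T ↔ y ∈ F.ch u ∧ ∀ z ∈ F.Z, F.top z ≠ y := by
    intro y
    rw [hT, mem_sdiff, mem_union, mB, mS]
    refine and_congr_right fun _ => ⟨fun h z hz e => h ?_, ?_⟩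
    · by_cases hl : F.Long z
      · exact .inr ⟨z, hz, hl, e⟩
      · exact .inl ⟨z, hz, hl, e⟩
    · rintro h (⟨z, hz, -, e⟩ | ⟨z, hz, -, e⟩) <;> exact h z hz e
  have hBS : Disjoint B S := by
    rw [disjoint_left]
    intro y h1 h2
    obtain ⟨z, hz, hl, e⟩ := mB.1 h1
    obtain ⟨z', hz', hl', e'⟩ := mS.1 h2
    obtain rfl := F.injOn_top hz hz' (e.trans e'.symm)
    exact hl hl'
  have hd : Disjoint (B ∪ S) T := disjoint_sdiff
  have hBT : Disjoint B T := disjoint_of_subset_left subset_union_left hd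
  have hST : Disjoint S T := disjoint_of_subset_left subset_union_right hd
  have hBSz : B ∪ S = F.zs.image F.top := by
    rw [hB, hS, ← image_union, union_comm, filter_union_filter_not_eq]
  have hinj : Set.InjOn F.top F.zs := by
    intro a ha b hb
    exact F.injOn_top (by simpa using ha) (by simpa using hb)
  have hsub : B ∪ S ⊆ F.ch u := by
    rw [hBSz]
    intro y hy
    obtain ⟨z, hz, rfl⟩ := mem_image.1 hy
    exact top_mem_ch (by simpa using hz)
  have hall : B ∪ S ∪ T = F.ch u := union_sdiff_of_subset hsub
  have hcz : #B + #S = #F.zs := by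
    rw [← card_union_of_disjoint hBS, hBSz, card_image_of_injOn hinj]
  have hcT : #F.zs + #T = #(F.ch u) := by
    rw [← hcz, ← card_union_of_disjoint hBS, ← card_union_of_disjoint hd, hall]
  -- the values
  have hB2 : ∀ z ∈ F.Z, ¬ F.Long z → ∃ q, (q = 2 ∨ q = 3) ∧
      ∀ κ o, o ≠ κ z → F.Val κ (F.top z) o q := by
    intro z hz hl
    have h1 := one_le_card_ch_top hz
    have hb := hbal z hz
    by_cases h2 : 2 ≤ #(F.ch (F.top z))
    · exact (exists_val_of_two_le hz h2 hb).1
    · have hp : F.par z = F.top z := by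
        by_contra hp
        exact hl ⟨by omega, hp⟩
      exact ⟨2, .inl rfl, exists_val_of_triangle hz (card_eq_zero.1 (by omega)) (by omega) hp⟩
  have hS2 : ∀ z ∈ F.Z, F.Long z → ∃ q, (q = 1 ∨ q = 2) ∧
      ∀ κ, F.Val κ (F.top z) (κ z) q := by
    intro z hz hl
    have hb := hbal z hz
    have h1 := hl.1
    exact exists_val_of_long hz (card_eq_zero.1 (by omega)) hl.1 hl.2
  have hT2 : ∀ y ∈ T, ∃ q, ((¬ X y → q = 1 ∨ q = 2) ∧ (X y → q = 3)) ∧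
      ∀ κ o, F.Val κ y o q := by
    intro y hy
    rw [mT] at hy
    have hyu := (F.mem_ch.1 hy.1)
    have hfree : F.Free y := free_of_top_ne fun z hz => by
      rw [F.top_of_par_eq y hyu.1 hyu.2]
      exact hy.2 z hz
    by_cases hXy : X y
    · exact ⟨3, by simp [hXy], hfree.val_three hyu.1 (hXc y hy.1 hXy hy.2)⟩
    · obtain ⟨q, hq, h⟩ := hfree.exists_val_le_two hyu.1
      exact ⟨q, by simp [hXy, hq], h⟩
  have hval : ∀ y, ∃ n : ℕ, (∀ z ∈ F.Z, F.top z = y → F.Long z → (n = 1 ∨ n = 2) ∧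
      ∀ κ, F.Val κ y (κ z) n) ∧ (∀ z ∈ F.Z, F.top z = y → ¬ F.Long z → (n = 2 ∨ n = 3) ∧
      ∀ κ o, o ≠ κ z → F.Val κ y o n) ∧ (y ∈ T → ((¬ X y → n = 1 ∨ n = 2) ∧ (X y → n = 3)) ∧
      ∀ κ o, F.Val κ y o n) := by
    intro y
    by_cases hyB : y ∈ B
    · obtain ⟨z, hz, hl, rfl⟩ := mB.1 hyB
      obtain ⟨n, hn⟩ := hB2 z hz hl
      refine ⟨n, fun z' hz' e hl' => ?_, fun z' hz' e hl' => ?_,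
        fun h => absurd h (disjoint_left.1 hBT hyB)⟩ <;> obtain rfl := F.injOn_top hz' hz e
      · exact absurd hl' hl
      · exact hn
    by_cases hyS : y ∈ S
    · obtain ⟨z, hz, hl, rfl⟩ := mS.1 hyS
      obtain ⟨n, hn⟩ := hS2 z hz hl
      refine ⟨n, fun z' hz' e hl' => ?_, fun z' hz' e hl' => ?_,
        fun h => absurd h (disjoint_left.1 hST hyS)⟩ <;> obtain rfl := F.injOn_top hz' hz e
      · exact hn
      · exact absurd hl hl'
    by_cases hyT : y ∈ T
    · obtain ⟨n, hn⟩ := hT2 y hyT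
      exact ⟨n, fun z hz e => absurd e ((mT.1 hyT).2 z hz),
        fun z hz e => absurd e ((mT.1 hyT).2 z hz), fun _ => hn⟩
    · exact ⟨0, fun z hz e hl => absurd (mS.2 ⟨z, hz, hl, e⟩) hyS,
        fun z hz e hl => absurd (mB.2 ⟨z, hz, hl, e⟩) hyB, fun h => absurd h hyT⟩
  -- The value function is kept variable, because the exceptional case alters it at one cycle.
  have finish : ∀ (q : V → ℕ) (wc zc : V → Fin 3), IsRootColoring B S T X q wc zc →
      (∀ z ∈ F.Z, F.Long z → q (F.top z) ≤ 2 ∧ ∀ κ, F.Val κ (F.top z) (κ z) (q (F.top z))) →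
      (∀ z ∈ F.Z, ¬ F.Long z → 2 ≤ q (F.top z) ∧
        ∀ κ o, o ≠ κ z → F.Val κ (F.top z) o (q (F.top z))) →
      (∀ y ∈ T, ((¬ X y → q y ≤ 2) ∧ (X y → q y = 3)) ∧ ∀ κ o, F.Val κ y o (q y)) →
      ∃ (κ A : V → Fin 3) (q : V → ℕ), (∀ y ∈ F.ch u, F.Val κ y (A y) (q y)) ∧
      (∀ y ∈ F.ch u, q y ≠ F.rootDeg κ A (A y)) ∧ (∀ z ∈ F.Z, 2 ≤ F.rootDeg κ A (κ z)) ∧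
      (∀ z ∈ F.Z, (F.Long z ∧ κ z = A (F.top z) ∧ q (F.top z) ≤ 2) ∨
        (κ z ≠ A (F.top z) ∧ 2 ≤ q (F.top z))) ∧
      (∀ y ∈ F.ch u, (∀ z ∈ F.Z, F.top z ≠ y) → (¬ X y → q y ≤ 2) ∧ (X y → q y = 3)) := by
    rintro q wc zc ⟨rS, rB, rT⟩ qS qB qT
    have hsize : ∀ j, F.rootDeg (fun z => zc (F.top z)) wc j = rootSize B S T wc zc j := by
      intro j
      rw [rootDeg, rootSize, hall, hBSz, filter_image, card_image_of_injOn]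
      exact hinj.mono fun a ha => mem_coe.2 (mem_filter.1 (mem_coe.1 ha)).1
    refine ⟨fun z => zc (F.top z), wc, q, fun y hy => ?_, fun y hy => ?_, fun z hz => ?_,
      fun z hz => ?_, fun y hy hyz => (qT y (mT.2 ⟨hy, hyz⟩)).1⟩
    · rw [← hall, mem_union, mem_union] at hy
      rcases hy with (hy | hy) | hy
      · have := rB y hy
        obtain ⟨z, hz, hl, rfl⟩ := mB.1 hy
        exact (qB z hz hl).2 _ _ this.1
      · have := rS y hy
        obtain ⟨z, hz, hl, rfl⟩ := mS.1 hy
        rw [this.1]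
        exact (qS z hz hl).2 _
      · exact (qT y hy).2 _ _
    · rw [hsize]
      rw [← hall, mem_union, mem_union] at hy
      rcases hy with (hy | hy) | hy
      · exact (rB y hy).2.1.symm
      · have := (rS y hy).2
        obtain ⟨z, hz, hl, rfl⟩ := mS.1 hy
        have := (qS z hz hl).1
        omega
      · have h1 := rT y hy
        have h2 := (qT y hy).1
        by_cases hXy : X y
        · have := h1.2 hXy; have := h2.2 hXy; omega
        · have := h1.1 hXy; have := h2.1 hXy; omega
    · rw [hsize]
      beta_reduce
      by_cases hl : F.Long z
      · have := rS _ (mS.2 ⟨z, hz, hl, rfl⟩)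
        rw [this.1] at this
        omega
      · exact (rB _ (mB.2 ⟨z, hz, hl, rfl⟩)).2.2
    · by_cases hl : F.Long z
      · exact .inl ⟨hl, (rS _ (mS.2 ⟨z, hz, hl, rfl⟩)).1.symm, (qS z hz hl).1⟩
      · exact .inr ⟨(rB _ (mB.2 ⟨z, hz, hl, rfl⟩)).1.symm, (qB z hz hl).1⟩
  choose q qS qB qT using hval
  have qB' : ∀ y ∈ B, q y = 2 ∨ q y = 3 := by
    intro y hy
    obtain ⟨z, hz, hl, e⟩ := mB.1 hy
    exact (qB y z hz e hl).1
  have qS1 : ∀ z ∈ F.Z, F.Long z →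
      q (F.top z) ≤ 2 ∧ ∀ κ, F.Val κ (F.top z) (κ z) (q (F.top z)) := by
    intro z hz hl
    have := qS _ z hz rfl hl
    exact ⟨by omega, this.2⟩
  have qB1 : ∀ z ∈ F.Z, ¬ F.Long z → 2 ≤ q (F.top z) ∧
        ∀ κ o, o ≠ κ z → F.Val κ (F.top z) o (q (F.top z)) := by
    intro z hz hl
    have := qB _ z hz rfl hl
    exact ⟨by omega, this.2⟩
  have qT1 : ∀ y ∈ T, ((¬ X y → q y ≤ 2) ∧ (X y → q y = 3)) ∧ ∀ κ o, F.Val κ y o (q y) := by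
    intro y hy
    have := qT y hy
    exact ⟨⟨fun h => by have := this.1.1 h; omega, this.1.2⟩, this.2⟩
  -- In the exceptional case one cycle exchanges its value `2` or `3` for a value `n ≥ 3`, possible
  -- because its top vertex has two children or more.
  by_cases hsp : #B = 2 ∧ S = ∅ ∧ #T = 1 ∧ ∃ y ∈ T, X y
  · obtain ⟨hB2', hS0, hT1, y, hy, hXy⟩ := hsp
    have hz2 : #F.zs = 2 := by rw [← hcz, hB2', hS0]; simp
    obtain ⟨z, hz, h⟩ := hX hz2 (by omega) ⟨y, (mT.1 hy).1, hXy, (mT.1 hy).2⟩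
    have hnl : ∀ z ∈ F.Z, ¬ F.Long z := by
      intro z hz hl
      have := mS.2 ⟨z, hz, hl, rfl⟩
      simp [hS0] at this
    obtain ⟨n, hn, hv⟩ := (exists_val_of_two_le hz (h.resolve_right (hnl z hz)) (hbal z hz)).2
    have hzB : F.top z ∈ B := mB.2 ⟨z, hz, hnl z hz, rfl⟩
    obtain ⟨wc, zc, hr⟩ := exists_isRootColoring_special (T := T) (X := X)
      (q := Function.update q (F.top z) n) hBT hB2' hT1
      (fun y hy => by
        by_cases e : y = F.top z
        · subst e; simp; omega
        · rw [Function.update_of_ne e]; have := qB' y hy; omega)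
      hzB (by simpa using hn) (by
        obtain ⟨t, ht⟩ := card_eq_one.1 hT1
        have e : y = t := by simpa [ht] using hy
        rw [ht]
        simpa [← e] using hXy)
    rw [hS0] at finish
    refine finish _ wc zc hr (fun z' hz' hl => absurd hl (hnl z' hz')) (fun z' hz' hl => ?_)
      (fun y hy => ?_)
    · by_cases e : F.top z' = F.top z
      · obtain rfl := F.injOn_top hz' hz e
        simp only [Function.update_self]
        exact ⟨by omega, hv⟩
      · rw [Function.update_of_ne e]
        exact qB1 z' hz' hl
    · have : y ≠ F.top z := fun e => (mT.1 hy).2 z hz e.symm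
      rw [Function.update_of_ne this]
      exact qT1 y hy
  · obtain ⟨wc, zc, hr⟩ := exists_isRootColoring (X := X) (q := q) hBS hBT hST (by omega) qB'
      (fun h1 h2 h3 y hy hXy => hsp ⟨h1, h2, h3, y, hy, hXy⟩)
    exact finish q wc zc hr qS1 qB1 qT1

/-! ### From values to colorings -/

/-- A choice of colors realizing the values of the subtrees below the root. -/
theorem exists_coloring_of_val {κ A : V → Fin 3} {q : V → ℕ}
    (h : ∀ y ∈ F.ch u, F.Val κ y (A y) (q y)) :
    ∃ (f : V → Fin 3) (d : V → ℕ), (∀ y ∈ F.ch u, f y = A y ∧ d y = q y) ∧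
      (∀ x, x ≠ u → d x = classSize (F.ch x) f (f x) (f x)) ∧
      (∀ x, x ≠ u → ∀ y ∈ F.ch x, d y ≠ classSize (F.ch x) f (f x) (f y)) ∧
      ∀ x ∈ F.Z, κ x ≠ f x ∧ ∀ y ∈ F.ch x, f y ≠ κ x := by
  have step : ∀ x o n, F.Val κ x o n → ∃ (A' : V → Fin 3) (q' : V → ℕ),
      (x ∈ F.Z → κ x ≠ o ∧ ∀ y ∈ F.ch x, A' y ≠ κ x) ∧
      (∀ y ∈ F.ch x, F.Val κ y (A' y) (q' y)) ∧
      (∀ y ∈ F.ch x, q' y ≠ classSize (F.ch x) A' o (A' y)) ∧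
      n = classSize (F.ch x) A' o o := by
    intro x o n hv
    cases hv with
    | mk _ _ A' q' hx hv hne => exact ⟨A', q', hx, hv, hne, rfl⟩
  have step' : ∀ (x : V) (o : Fin 3) (n : ℕ), ∃ (A' : V → Fin 3) (q' : V → ℕ),
      F.Val κ x o n → (x ∈ F.Z → κ x ≠ o ∧ ∀ y ∈ F.ch x, A' y ≠ κ x) ∧
      (∀ y ∈ F.ch x, F.Val κ y (A' y) (q' y)) ∧
      (∀ y ∈ F.ch x, q' y ≠ classSize (F.ch x) A' o (A' y)) ∧
      n = classSize (F.ch x) A' o o := by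
    intro x o n
    by_cases hv : F.Val κ x o n
    · obtain ⟨A', q', h⟩ := step x o n hv
      exact ⟨A', q', fun _ => h⟩
    · exact ⟨A, q, fun h => absurd h hv⟩
  choose A' q' hA' using step'
  classical
  have wf : WellFounded fun x y : V => F.ht x < F.ht y := InvImage.wf F.ht wellFounded_lt
  -- Colours and values are fixed from the root downwards, each vertex passing on the choices made
  -- for its children. The pair `(0, 0)` at the root is a dummy.
  let st : V → Fin 3 × ℕ := wf.fix fun x rec =>
    if hx : x = u then (0, 0)
    else if F.par x = u then (A x, q x)
    else (A' (F.par x) (rec _ (F.ht_par x hx)).1 (rec _ (F.ht_par x hx)).2 x,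
      q' (F.par x) (rec _ (F.ht_par x hx)).1 (rec _ (F.ht_par x hx)).2 x)
  have st_root : ∀ y ∈ F.ch u, st y = (A y, q y) := by
    intro y hy
    rw [mem_ch] at hy
    simp only [st]
    rw [wf.fix_eq]
    simp [hy.1, hy.2]
  have st_ch : ∀ x, x ≠ u → ∀ y ∈ F.ch x,
      st y = (A' x (st x).1 (st x).2 y, q' x (st x).1 (st x).2 y) := by
    intro x hx y hy
    rw [mem_ch] at hy
    obtain ⟨hyu, rfl⟩ := hy
    simp only [st]
    rw [wf.fix_eq]
    simp [hyu, hx]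
  have hval : ∀ x, x ≠ u → F.Val κ x (st x).1 (st x).2 := by
    intro x
    induction x using wf.induction with
    | _ x ih =>
      intro hx
      by_cases hp : F.par x = u
      · have hm : x ∈ F.ch u := by simp [hx, hp]
        rw [st_root x hm]
        exact h x hm
      · have hm : x ∈ F.ch (F.par x) := by simp [hx]
        rw [st_ch _ hp x hm]
        exact (hA' _ _ _ (ih _ (F.ht_par x hx) hp)).2.1 x hm
  have hcs : ∀ x, x ≠ u → ∀ j, classSize (F.ch x) (fun y => (st y).1) (st x).1 j =
      classSize (F.ch x) (A' x (st x).1 (st x).2) (st x).1 j := by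
    intro x hx j
    rw [classSize, classSize]
    congr 2
    exact filter_congr fun y hy => by rw [st_ch x hx y hy]
  refine ⟨fun x => (st x).1, fun x => (st x).2, fun y hy => ?_, fun x hx => ?_,
    fun x hx y hy => ?_, fun x hx => ?_⟩
  · simp [st_root y hy]
  · rw [hcs x hx]
    exact (hA' _ _ _ (hval x hx)).2.2.2
  · rw [hcs x hx]
    beta_reduce
    rw [st_ch x hx y hy]
    exact (hA' _ _ _ (hval x hx)).2.2.1 y hy
  · have hxu := F.ne_root x hx
    obtain ⟨h1, h2⟩ := (hA' _ _ _ (hval x hxu)).1 hx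
    refine ⟨h1, fun y hy => ?_⟩
    beta_reduce
    rw [st_ch x hxu y hy]
    exact h2 y hy

end Frame


/-! ### The edge colouring described by a frame -/

lemma mem_ite_singleton {V : Type*} {p : Prop} [Decidable p] {a y : V} :
    y ∈ (if p then {a} else ∅ : Finset V) ↔ p ∧ y = a := by
  split_ifs <;> simp [*]

namespace Frame

variable {V : Type*} [Fintype V] {G : SimpleGraph V} {u : V} (F : Frame G u)

lemma adj_iff' (x y : V) : G.Adj x y ↔ y ∈ F.ch x ∨ x ∈ F.ch y ∨ (x = u ∧ y ∈ F.Z) ∨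
    (y = u ∧ x ∈ F.Z) := by
  rw [F.adj_iff, mem_ch, mem_ch]

variable {F} in
lemma notMem_ch_of_mem_ch {x y : V} (h : y ∈ F.ch x) : x ∉ F.ch y := fun h' => by
  have := F.ht_lt_of_mem_ch h
  have := F.ht_lt_of_mem_ch h'
  omega

variable {F} in
lemma notMem_Z_of_mem_ch_root {y : V} (h : y ∈ F.ch u) : y ∉ F.Z := fun hz =>
  F.par_ne_root y hz (F.mem_ch.1 h).2

open Classical in
/-- The coloring in which `f x` is the color of the edge from `x` to its parent and `κ z` that of
the edge `uz`, for `z ∈ Z`. -/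
noncomputable def coloring (f κ : V → Fin 3) : G.EdgeLabeling (Fin 3) :=
  .mk (fun x y _ => if y ∈ F.ch x then f y else if x ∈ F.ch y then f x else
    if x = u then κ y else κ x) (by
      intro x y h
      by_cases h1 : y ∈ F.ch x
      · simp [h1, notMem_ch_of_mem_ch h1]
      · by_cases h2 : x ∈ F.ch y
        · simp [h2, notMem_ch_of_mem_ch h2]
        · rw [F.adj_iff'] at h
          simp only [h1, h2, false_or, if_false] at h ⊢
          rcases h with ⟨rfl, h⟩ | ⟨rfl, h⟩ <;> simp [F.ne_root _ h])

lemma labelGraph_coloring_adj (f κ : V → Fin 3) (j : Fin 3) (x y : V) :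
    ((F.coloring f κ).labelGraph j).Adj x y ↔ (y ∈ F.ch x ∧ f y = j) ∨ (x ∈ F.ch y ∧ f x = j) ∨
      (x = u ∧ y ∈ F.Z ∧ κ y = j) ∨ (y = u ∧ x ∈ F.Z ∧ κ x = j) := by
  rw [SimpleGraph.EdgeLabeling.labelGraph_adj]
  simp only [← SimpleGraph.EdgeLabeling.get_eq, coloring, SimpleGraph.EdgeLabeling.get_mk,
    exists_prop]
  rw [F.adj_iff']
  by_cases h1 : y ∈ F.ch x
  · have hx : x ∈ F.Z → y ≠ u := fun _ => (F.mem_ch.1 h1).1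
    have hy : x = u → y ∉ F.Z := by rintro rfl; exact notMem_Z_of_mem_ch_root h1
    simp [h1, notMem_ch_of_mem_ch h1]
    tauto
  · by_cases h2 : x ∈ F.ch y
    · have hx : y ∈ F.Z → x ≠ u := fun _ => (F.mem_ch.1 h2).1
      have hy : y = u → x ∉ F.Z := by rintro rfl; exact notMem_Z_of_mem_ch_root h2
      simp [h1, h2]
      tauto
    · by_cases hx : x = u
      · subst hx
        have := F.ne_root x
        simp only [h1, h2, if_false, false_and, false_or, if_true, true_and]
        tauto
      · simp only [h1, h2, if_false, false_and, false_or, hx, and_assoc]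

lemma deg_eq (x : V) (hx : x ≠ u) [Decidable (x ∈ F.Z)] :
    deg G x = #(F.ch x) + 1 + if x ∈ F.Z then 1 else 0 := by
  classical
  have : G.neighborSet x =
      ↑(F.ch x ∪ ({F.par x} ∪ if x ∈ F.Z then {u} else ∅) : Finset V) := by
    ext y
    rw [SimpleGraph.mem_neighborSet, F.adj_iff', mem_coe, mem_union, mem_union, mem_singleton,
      mem_ite_singleton, F.mem_ch (x := y)]
    have : F.par x = y ↔ y = F.par x := eq_comm
    tauto
  rw [deg, this, Set.ncard_coe_finset, card_union_of_disjoint, card_union_of_disjoint]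
  · by_cases hz : x ∈ F.Z <;> simp [hz, add_assoc]
  · by_cases hz : x ∈ F.Z
    · simpa [hz] using F.par_ne_root x hz
    · simp [hz]
  · rw [disjoint_left]
    intro y hy hy'
    rw [mem_union, mem_singleton] at hy'
    rcases hy' with rfl | hy'
    · have := F.ht_lt_of_mem_ch hy
      have := F.ht_par x hx
      omega
    · by_cases hz : x ∈ F.Z
      · simp [hz] at hy'
        exact (F.mem_ch.1 hy).1 hy'
      · simp [hz] at hy'

lemma colorDeg_coloring (f κ : V → Fin 3) (j : Fin 3) (x : V) (hx : x ≠ u)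
    [Decidable (x ∈ F.Z ∧ κ x = j)] :
    colorDeg (F.coloring f κ) j x =
      classSize (F.ch x) f (f x) j + if x ∈ F.Z ∧ κ x = j then 1 else 0 := by
  classical
  have : ((F.coloring f κ).labelGraph j).neighborSet x =
      ↑((if f x = j then {F.par x} else ∅) ∪ ({y ∈ F.ch x | f y = j} : Finset V) ∪
        (if x ∈ F.Z ∧ κ x = j then {u} else ∅) : Finset V) := by
    ext y
    rw [SimpleGraph.mem_neighborSet, F.labelGraph_coloring_adj, mem_coe, mem_union, mem_union,
      mem_ite_singleton, mem_ite_singleton, mem_filter, F.mem_ch (x := y)]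
    have : F.par x = y ↔ y = F.par x := eq_comm
    tauto
  rw [colorDeg, deg, this, Set.ncard_coe_finset, card_union_of_disjoint, card_union_of_disjoint]
  · rw [classSize]
    split_ifs <;> simp
  · rw [disjoint_left]
    intro y hy hy'
    by_cases hf : f x = j
    · simp only [hf, if_true, mem_singleton] at hy
      subst hy
      have := F.ht_lt_of_mem_ch (mem_filter.1 hy').1
      have := F.ht_par x hx
      omega
    · simp [hf] at hy
  · rw [disjoint_left]
    intro y hy hy'
    by_cases hz : x ∈ F.Z ∧ κ x = j
    · simp only [hz, and_self, if_true, mem_singleton] at hy'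
      subst hy'
      rw [mem_union] at hy
      rcases hy with hy | hy
      · by_cases hf : f x = j
        · simp only [hf, if_true, mem_singleton] at hy
          exact F.par_ne_root x hz.1 hy.symm
        · simp [hf] at hy
      · exact (F.mem_ch.1 (mem_filter.1 hy).1).1 rfl
    · simp [hz] at hy'

lemma colorDeg_coloring_root (f κ : V → Fin 3) (j : Fin 3) :
    colorDeg (F.coloring f κ) j u = F.rootDeg κ f j := by
  classical
  have : ((F.coloring f κ).labelGraph j).neighborSet u =
      ↑(({y ∈ F.ch u | f y = j} : Finset V) ∪ ({z ∈ F.zs | κ z = j} : Finset V)) := by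
    ext y
    rw [SimpleGraph.mem_neighborSet, F.labelGraph_coloring_adj]
    have := F.ne_root u
    simp
    tauto
  rw [colorDeg, deg, this, Set.ncard_coe_finset, card_union_of_disjoint, rootDeg]
  rw [disjoint_left]
  intro y hy hy'
  exact notMem_Z_of_mem_ch_root (mem_filter.1 hy).1 (by simpa using (mem_filter.1 hy').1)

variable {F}

/-- Colors of the edges at the root and values of the subtrees that fit together give a locally
irregular coloring. -/
theorem exists_isLiec {κ A : V → Fin 3} {q : V → ℕ}
    (h : ∀ y ∈ F.ch u, F.Val κ y (A y) (q y))
    (hA : ∀ y ∈ F.ch u, q y ≠ F.rootDeg κ A (A y)) (hZ : ∀ z ∈ F.Z, 2 ≤ F.rootDeg κ A (κ z)) :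
    ∃ C : G.EdgeLabeling (Fin 3), IsLiec C ∧
      (∀ y ∈ F.ch u, (C.labelGraph (A y)).Adj u y ∧ colorDeg C (A y) y = q y) ∧
      (∀ z ∈ F.Z, (C.labelGraph (κ z)).Adj u z ∧ colorDeg C (κ z) z = 1) := by
  classical
  obtain ⟨f, d, hf, hd, hne, hκ⟩ := exists_coloring_of_val h
  have hroot : ∀ j, colorDeg (F.coloring f κ) j u = F.rootDeg κ A j := by
    intro j
    rw [colorDeg_coloring_root, rootDeg, rootDeg]
    congr 2
    exact filter_congr fun y hy => by rw [(hf y hy).1]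
  -- An edge `ux` with `x ∈ F.Z` adds nothing to the colour of the parent edge, since `κ x ≠ f x`.
  have hown : ∀ x, x ≠ u → colorDeg (F.coloring f κ) (f x) x = d x := by
    intro x hx
    rw [colorDeg_coloring _ _ _ _ _ hx, if_neg, hd x hx, add_zero]
    exact fun hz => (hκ x hz.1).1 hz.2
  have hz1 : ∀ z ∈ F.Z, colorDeg (F.coloring f κ) (κ z) z = 1 := by
    intro z hz
    rw [colorDeg_coloring _ _ _ _ _ (F.ne_root z hz), if_pos ⟨hz, rfl⟩, classSize,
      if_neg (hκ z hz).1.symm, card_eq_zero.2]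
    rw [filter_eq_empty_iff]
    exact (hκ z hz).2
  have hch : ∀ x y, y ∈ F.ch x →
      colorDeg (F.coloring f κ) (f y) x ≠ colorDeg (F.coloring f κ) (f y) y := by
    intro x y hy
    rw [hown y (F.mem_ch.1 hy).1]
    by_cases hx : x = u
    · subst hx
      rw [hroot, (hf y hy).1, (hf y hy).2]
      exact (hA y hy).symm
    · rw [colorDeg_coloring _ _ _ _ _ hx, if_neg fun hz => (hκ x hz.1).2 y hy hz.2.symm]
      exact (hne x hx y hy).symm
  refine ⟨F.coloring f κ, fun j x y hxy => ?_, fun y hy => ⟨?_, ?_⟩, fun z hz => ⟨?_, hz1 z hz⟩⟩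
  · rw [labelGraph_coloring_adj] at hxy
    rcases hxy with ⟨hy, rfl⟩ | ⟨hx, rfl⟩ | ⟨rfl, hy, rfl⟩ | ⟨rfl, hx, rfl⟩
    · exact hch x y hy
    · exact (hch y x hx).symm
    · have h1 := hz1 y hy
      have h2 := hZ y hy
      rw [← hroot] at h2
      unfold colorDeg at h1 h2
      omega
    · have h1 := hz1 x hx
      have h2 := hZ x hx
      rw [← hroot] at h2
      unfold colorDeg at h1 h2
      omega
  · rw [labelGraph_coloring_adj]
    exact .inl ⟨hy, (hf y hy).1⟩
  · rw [← (hf y hy).1, hown y (F.mem_ch.1 hy).1]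
    exact (hf y hy).2
  · rw [labelGraph_coloring_adj]
    exact .inr (.inr (.inl ⟨rfl, hz, rfl⟩))

end Frame


variable {V : Type*} {G : SimpleGraph V} {u : V}

/-! ### The structure of grapes -/

/-- The component of `G - u` that contains `x`. -/
def compOf (G : SimpleGraph V) {u x : V} (hx : x ≠ u) :
    (G.induce ({u}ᶜ : Set V)).ConnectedComponent :=
  (G.induce ({u}ᶜ : Set V)).connectedComponentMk ⟨x, Set.mem_compl_singleton_iff.2 hx⟩

lemma compOf_eq_of_adj {x y : V} (hx : x ≠ u) (hy : y ≠ u) (h : G.Adj x y) :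
    compOf G hx = compOf G hy :=
  SimpleGraph.ConnectedComponent.connectedComponentMk_eq_of_adj (by simpa using h)

lemma mem_berrySet {x : V} {K : (G.induce ({u}ᶜ : Set V)).ConnectedComponent} :
    x ∈ berrySet G u K ↔ x = u ∨ ∃ hx : x ≠ u, compOf G hx = K := by
  rw [berrySet, Set.mem_insert_iff]
  refine or_congr_right ⟨?_, ?_⟩
  · rintro ⟨⟨y, hy⟩, hK, rfl⟩
    exact ⟨Set.mem_compl_singleton_iff.1 hy, hK⟩
  · rintro ⟨hx, rfl⟩
    exact ⟨⟨x, Set.mem_compl_singleton_iff.2 hx⟩, rfl, rfl⟩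

lemma exists_walk_of_induce {s : Set V} {a b : s} (p : (G.induce s).Walk a b) :
    ∃ q : G.Walk a b, q.support = p.support.map Subtype.val := by
  induction p with
  | nil => exact ⟨.nil, by simp⟩
  | cons h p ih =>
    obtain ⟨q, hq⟩ := ih
    exact ⟨.cons (by simpa using h) q, by simp [hq]⟩

/-- A path from `x` to `y` inside `G - u` closes up through `u`, and uses no other edge at `u`. -/
lemma exists_cycle_of_compOf_eq {x y : V} (hxy : x ≠ y) (hx : G.Adj u x) (hy : G.Adj u y)
    (h : compOf G hx.ne' = compOf G hy.ne') :
    ∃ s ∈ cycles G, s(u, x) ∈ s ∧ s(u, y) ∈ s ∧ ∀ z, s(u, z) ∈ s → z = x ∨ z = y := by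
  obtain ⟨p, hp⟩ := (SimpleGraph.ConnectedComponent.exact h).exists_isPath
  obtain ⟨q, hqs⟩ := exists_walk_of_induce p
  have hq : q.IsPath := by
    rw [SimpleGraph.Walk.isPath_def] at hp ⊢
    rw [hqs]
    exact hp.map Subtype.val_injective
  have hu : u ∉ q.support := by
    rw [hqs]
    simp
  have hr : (q.concat hy.symm).IsPath := (SimpleGraph.Walk.concat_isPath_iff _).2 ⟨hq, hu⟩
  have he : ∀ z, s(u, z) ∈ (q.concat hy.symm).edges → z = y := by
    intro z hz
    rw [SimpleGraph.Walk.edges_concat, List.concat_eq_append, List.mem_append] at hz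
    rcases hz with hz | hz
    · exact absurd (SimpleGraph.Walk.fst_mem_support_of_mem_edges _ hz) hu
    · simp only [List.mem_singleton, Sym2.eq_iff] at hz
      exact hz.elim (fun h => absurd h.1 hy.ne) And.right
  have hc : (SimpleGraph.Walk.cons hx (q.concat hy.symm)).IsCycle :=
    (SimpleGraph.Walk.cons_isCycle_iff _ _).2 ⟨hr, fun h => hxy (he x h)⟩
  refine ⟨_, ⟨u, _, hc, rfl⟩, ?_, ?_, fun z hz => ?_⟩
  · simp
  · simp [SimpleGraph.Walk.edges_concat]
  · rw [Set.mem_ofPred_eq, SimpleGraph.Walk.edges_cons, List.mem_cons] at hz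
    rcases hz with hz | hz
    · rw [Sym2.eq_iff] at hz
      exact .inl (hz.elim And.right fun h => absurd h.1 hx.ne)
    · exact .inr (he z hz)

/-- Rotated to start at `u`, the cycle has a first and a last edge at `u`; the rest of it is a path
in `G - u` joining their other ends. -/
lemma exists_adj_of_mem_cycles {s : Set (Sym2 V)} (hs : s ∈ cycles G) {e : Sym2 V} (he : e ∈ s)
    (hue : u ∈ e) : ∃ (x y : V) (hx : G.Adj u x) (hy : G.Adj u y), x ≠ y ∧ s(u, x) ∈ s ∧
      s(u, y) ∈ s ∧ compOf G hx.ne' = compOf G hy.ne' := by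
  classical
  obtain ⟨x₀, p, hp, rfl⟩ := hs
  have hus : u ∈ p.support := by
    obtain ⟨v, rfl⟩ := hue
    exact SimpleGraph.Walk.fst_mem_support_of_mem_edges _ he
  have hp' := (SimpleGraph.Walk.isCycle_rotate hus).2 hp
  have hed : ∀ e, e ∈ p.edges ↔ e ∈ (p.rotate u hus).edges := fun e =>
    (p.rotate_edges u hus).mem_iff.symm
  simp only [Set.mem_ofPred_eq, hed]
  generalize p.rotate u hus = c at hp'
  cases c with
  | nil => exact absurd rfl hp'.ne_nil
  | @cons _ x _ hx q =>
    obtain ⟨hq, hxe⟩ := (SimpleGraph.Walk.cons_isCycle_iff _ _).1 hp'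
    have hqr : q.reverse.reverse = q := SimpleGraph.Walk.reverse_reverse q
    have hr := hq.reverse
    generalize q.reverse = r at hqr hr
    cases r with
    | nil => exact absurd rfl hx.ne
    | @cons _ y _ hy r =>
      subst hqr
      obtain ⟨hr', hur⟩ := (SimpleGraph.Walk.cons_isPath_iff _ _).1 hr
      have hm : s(u, y) ∈ (SimpleGraph.Walk.cons hy r).reverse.edges := by
        rw [SimpleGraph.Walk.edges_reverse]; simp
      refine ⟨x, y, hx, hy, ?_, ?_, ?_, ?_⟩
      · rintro rfl; exact hxe hm
      · simp
      · rw [SimpleGraph.Walk.edges_cons]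
        exact List.mem_cons_of_mem _ hm
      · have hs : ∀ z ∈ r.support, z ∈ ({u}ᶜ : Set V) := by
          intro z hz
          rw [Set.mem_compl_singleton_iff]
          rintro rfl
          exact hur hz
        exact (SimpleGraph.ConnectedComponent.sound (r.induce ({u}ᶜ : Set V) hs).reachable).symm

/-- A third neighbour in the component would give a second cycle through the edge `ux`. By
edge-disjointness the two cycles coincide, and the first meets `u` only in `ux` and `uy`. -/
lemma IsGrape.eq_or_eq_of_compOf_eq (hG : IsGrape G u) {x y z : V} (hxy : x ≠ y)
    (hx : G.Adj u x) (hy : G.Adj u y) (hz : G.Adj u z)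
    (hxy' : compOf G hx.ne' = compOf G hy.ne') (hxz' : compOf G hx.ne' = compOf G hz.ne') :
    z = x ∨ z = y := by
  by_cases hxz : z = x
  · exact .inl hxz
  obtain ⟨s, hs, h1, h2, h3⟩ := exists_cycle_of_compOf_eq hxy hx hy hxy'
  obtain ⟨t, ht, h1', h2', -⟩ := exists_cycle_of_compOf_eq (Ne.symm hxz) hx hz hxz'
  obtain rfl : s = t := by
    by_contra hne
    exact Set.disjoint_left.1 (hG.1.2 hs ht hne) h1 h1'
  exact h3 z h2'

/-- A walk to `u` stays in the component until the step that first reaches `u`. -/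
lemma exists_adj_compOf_eq (hG : G.Connected) (K : (G.induce ({u}ᶜ : Set V)).ConnectedComponent) :
    ∃ (x : V) (hx : G.Adj u x), compOf G hx.ne' = K := by
  induction K using SimpleGraph.ConnectedComponent.ind with
  | _ x =>
    obtain ⟨x, hx⟩ := x
    have hxu := Set.mem_compl_singleton_iff.1 hx
    change ∃ (y : V) (hy : G.Adj u y), compOf G hy.ne' = compOf G hxu
    obtain ⟨p⟩ := hG.preconnected x u
    clear hx
    induction p with
    | nil => exact absurd rfl hxu
    | @cons a b c h p ih =>
      by_cases hb : b = c
      · subst hb; exact ⟨a, h.symm, rfl⟩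
      · obtain ⟨y, hy, e⟩ := ih hb
        exact ⟨y, hy, e.trans (compOf_eq_of_adj hxu hb h).symm⟩

/-! ### Parents in a rooted tree -/

section tree

variable {T : SimpleGraph V}

/-- In a tree, the path from a vertex to the root. -/
noncomputable def rootPath (hT : T.IsTree) (u x : V) : T.Walk x u :=
  (hT.existsUnique_path x u).choose

lemma rootPath_isPath (hT : T.IsTree) (u x : V) : (rootPath hT u x).IsPath :=
  (hT.existsUnique_path x u).choose_spec.1

lemma eq_rootPath (hT : T.IsTree) {u x : V} {p : T.Walk x u} (hp : p.IsPath) :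
    p = rootPath hT u x :=
  (hT.existsUnique_path x u).choose_spec.2 p hp

lemma adj_snd_rootPath (hT : T.IsTree) {u x : V} (hx : x ≠ u) :
    T.Adj x (rootPath hT u x).snd :=
  SimpleGraph.Walk.adj_snd (SimpleGraph.Walk.not_nil_of_ne hx)

lemma length_rootPath_snd (hT : T.IsTree) {u x : V} (hx : x ≠ u) :
    (rootPath hT u (rootPath hT u x).snd).length < (rootPath hT u x).length := by
  rw [← eq_rootPath hT (rootPath_isPath hT u x).tail]
  have := SimpleGraph.Walk.length_tail_add_one (SimpleGraph.Walk.not_nil_of_ne hx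
    (p := rootPath hT u x))
  omega

/-- Either `y` lies on the path from `x` to the root, and is then its second vertex, or `y` can be
prepended to that path. -/
lemma snd_rootPath_of_adj (hT : T.IsTree) {u x y : V} (h : T.Adj x y) :
    (y ≠ u ∧ (rootPath hT u y).snd = x) ∨ (x ≠ u ∧ (rootPath hT u x).snd = y) := by
  by_cases hy : y ∈ (rootPath hT u x).support
  · right
    refine ⟨?_, (hT.isAcyclic.eq_snd_of_adj_start (rootPath_isPath hT u x) h hy).symm⟩
    rintro rfl
    rw [← eq_rootPath hT (SimpleGraph.Walk.IsPath.nil (u := x))] at hy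
    simp at hy
    exact h.ne' hy
  · left
    have hp : (SimpleGraph.Walk.cons h.symm (rootPath hT u x)).IsPath :=
      (SimpleGraph.Walk.cons_isPath_iff _ _).2 ⟨rootPath_isPath hT u x, hy⟩
    refine ⟨?_, ?_⟩
    · rintro rfl
      exact hy (SimpleGraph.Walk.end_mem_support _)
    · rw [← eq_rootPath hT hp]
      simp

end tree

/-- A grape has a frame whose functions fit its components, such that the child of the root on a
cycle has at least the degree of the other neighbor of the root on the cycle. -/
theorem IsGrape.exists_frame [Fintype V] (hG : IsGrape G u) :
    ∃ F : Frame G u, (∀ z ∈ F.Z, deg G z ≤ deg G (F.top z)) ∧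
      ∀ x y (hx : x ≠ u) (hy : y ≠ u), F.top x = F.top y ↔ compOf G hx = compOf G hy := by
  classical
  have hw : ∀ K : (G.induce ({u}ᶜ : Set V)).ConnectedComponent, ∃ w : V,
      (∃ hw : G.Adj u w, compOf G hw.ne' = K) ∧
      ∀ x, ∀ hx : G.Adj u x, compOf G hx.ne' = K → deg G x ≤ deg G w := by
    intro K
    obtain ⟨w, hw, hmax⟩ := Finset.exists_max_image
      (univ.filter fun x : V => ∃ hx : G.Adj u x, compOf G hx.ne' = K) (deg G) (by
        obtain ⟨x, hx, h⟩ := exists_adj_compOf_eq hG.1.1 K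
        exact ⟨x, by simpa using ⟨hx, h⟩⟩)
    exact ⟨w, by simpa using hw, fun x hx h => hmax x (by simpa using ⟨hx, h⟩)⟩
  choose w hwK hwmax using hw
  choose hwadj hwcomp using hwK
  let top : V → V := fun x => if hx : x = u then u else w (compOf G hx)
  have top_eq : ∀ x (hx : x ≠ u), top x = w (compOf G hx) := fun x hx => by simp [top, hx]
  have winj : ∀ K L, w K = w L → K = L := by
    intro K L h
    rw [← hwcomp K, ← hwcomp L]
    simp only [h]
  have top_iff : ∀ x y (hx : x ≠ u) (hy : y ≠ u),
      top x = top y ↔ compOf G hx = compOf G hy := by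
    intro x y hx hy
    rw [top_eq x hx, top_eq y hy]
    exact ⟨winj _ _, fun h => by rw [h]⟩
  -- Each component keeps its edge to the neighbour `w` of largest degree; the set `Z` consists of
  -- the other neighbours of `u`.
  let Z : Set V := {z | G.Adj u z ∧ top z ≠ z}
  have memZ : ∀ z, z ∈ Z ↔ G.Adj u z ∧ top z ≠ z := fun z => Iff.rfl
  let T : SimpleGraph V :=
    { Adj := fun x y => G.Adj x y ∧ ¬ (x = u ∧ y ∈ Z) ∧ ¬ (y = u ∧ x ∈ Z)
      symm := ⟨fun x y h => ⟨h.1.symm, h.2.2, h.2.1⟩⟩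
      loopless := ⟨fun x h => h.1.ne rfl⟩ }
  have Tadj : ∀ x y, T.Adj x y ↔ G.Adj x y ∧ ¬ (x = u ∧ y ∈ Z) ∧ ¬ (y = u ∧ x ∈ Z) :=
    fun x y => Iff.rfl
  have hTG : T ≤ G := fun x y h => h.1
  have hTu : ∀ x, T.Adj u x → G.Adj u x ∧ top x = x := by
    intro x h
    refine ⟨h.1, ?_⟩
    by_contra hne
    exact h.2.1 ⟨rfl, h.1, hne⟩
  -- A cycle would pass through `u` and use two edges from `u` into one component, of which only one
  -- was kept.
  have hacyc : T.IsAcyclic := by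
    intro v c hc
    have hc' := hc.mapLe hTG
    have hs : {e | e ∈ (c.mapLe hTG).edges} ∈ cycles G := ⟨v, _, hc', rfl⟩
    obtain ⟨e, he, hue⟩ := hG.2.2 _ hs
    obtain ⟨x, y, hx, hy, hxy, hxs, hys, hcomp⟩ := exists_adj_of_mem_cycles hs he hue
    rw [Set.mem_ofPred_eq, SimpleGraph.Walk.edges_mapLe_eq_edges] at hxs hys
    have h1 := (hTu x (c.adj_of_mem_edges hxs)).2
    have h2 := (hTu y (c.adj_of_mem_edges hys)).2
    exact hxy (h1.symm.trans (((top_iff x y hx.ne' hy.ne').2 hcomp).trans h2))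
  have htopw : ∀ K, top (w K) = w K := by
    intro K
    rw [top_eq _ (hwadj K).ne', hwcomp]
  have hreach : ∀ x, T.Reachable x u := by
    intro x
    by_cases hx : x = u
    · rw [hx]
    · have h1 : (G.induce ({u}ᶜ : Set V)).Reachable ⟨x, Set.mem_compl_singleton_iff.2 hx⟩
          ⟨w (compOf G hx), Set.mem_compl_singleton_iff.2 (hwadj _).ne'⟩ :=
        SimpleGraph.ConnectedComponent.exact (hwcomp (compOf G hx)).symm
      have h2 := h1.map (⟨Subtype.val, fun {a b} h => by
        have ha := Set.mem_compl_singleton_iff.1 a.2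
        have hb := Set.mem_compl_singleton_iff.1 b.2
        exact (Tadj _ _).2 ⟨by simpa using h, by tauto, by tauto⟩⟩ :
        G.induce ({u}ᶜ : Set V) →g T)
      refine h2.trans (SimpleGraph.Adj.reachable ?_)
      change T.Adj (w (compOf G hx)) u
      rw [Tadj]
      refine ⟨(hwadj _).symm, fun h => (hwadj _).ne' h.1, fun h => h.2.2 (htopw _)⟩
  have hT : T.IsTree := ⟨(SimpleGraph.connected_iff _).2
    ⟨fun x y => (hreach x).trans (hreach y).symm, ⟨u⟩⟩, hacyc⟩
  have hpar : ∀ x, x ≠ u → T.Adj x (rootPath hT u x).snd := fun x hx => adj_snd_rootPath hT hx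
  refine ⟨{ par := fun x => (rootPath hT u x).snd
            ht := fun x => (rootPath hT u x).length
            Z := Z
            top := top
            ht_par := fun x hx => length_rootPath_snd hT hx
            adj_iff := fun x y => ⟨fun h => ?_, ?_⟩
            ne_root := fun z hz => hz.1.ne'
            par_ne_root := fun z hz h => ?_
            top_par := fun x hx hp => ?_
            top_of_par_eq := fun x hx hp => ?_
            injOn_top := fun x hx y hy h => ?_ }, fun z hz => ?_, top_iff⟩
  · by_cases hTxy : T.Adj x y
    · rcases snd_rootPath_of_adj hT (u := u) hTxy with h | h
      · exact .inl h
      · exact .inr (.inl h)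
    · rw [Tadj] at hTxy
      tauto
  · rintro (⟨hy, rfl⟩ | ⟨hx, rfl⟩ | ⟨rfl, h⟩ | ⟨rfl, h⟩)
    · exact (hpar y hy).1.symm
    · exact (hpar x hx).1
    · exact h.1
    · exact h.1.symm
  · have := hpar z hz.1.ne'
    rw [h] at this
    exact this.2.2 ⟨rfl, hz⟩
  · exact (top_iff _ _ hp hx).2 (compOf_eq_of_adj hx hp (hpar x hx).1).symm
  · have := hpar x hx
    rw [hp] at this
    exact (hTu x this.symm).2
  -- A component has at most two neighbours of `u`. Two of them in `Z` would leave none for `w`.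
  · by_contra hne
    have hc := (top_iff x y hx.1.ne' hy.1.ne').1 h
    rcases hG.eq_or_eq_of_compOf_eq hne hx.1 hy.1 (hwadj (compOf G hx.1.ne')) hc
      (hwcomp _).symm with h' | h'
    · exact hx.2 (by rw [top_eq x hx.1.ne', h'])
    · exact hy.2 (by rw [top_eq y hy.1.ne', ← hc, h'])
  · change deg G z ≤ deg G (top z)
    rw [top_eq z hz.1.ne']
    exact hwmax _ z hz.1 rfl

namespace Frame

variable [Fintype V] {F : Frame G u}

lemma adj_root_iff {x : V} : G.Adj u x ↔ x ∈ F.ch u ∨ x ∈ F.Z := by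
  rw [F.adj_iff']
  have := F.ne_root u
  constructor
  · rintro (h | h | h | h)
    · exact .inl h
    · exact absurd rfl (F.mem_ch.1 h).1
    · exact .inr h.2
    · exact absurd rfl (this h.2)
  · tauto

/-- Besides its children, `z` is adjacent to its parent and to `u`, whereas `F.top z` is adjacent
only to `u`, its parent. This accounts for the `1`. -/
lemma card_ch_le (hdeg : ∀ z ∈ F.Z, deg G z ≤ deg G (F.top z)) :
    ∀ z ∈ F.Z, #(F.ch z) + 1 ≤ #(F.ch (F.top z)) := by
  classical
  intro z hz
  have h := hdeg z hz
  have htop := top_mem_ch hz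
  rw [F.deg_eq _ (F.ne_root z hz), F.deg_eq _ (F.mem_ch.1 htop).1, if_pos hz,
    if_neg (notMem_Z_of_mem_ch_root htop)] at h
  omega

/-- A grape with at least two cycles has at least two components attached by two edges. -/
lemma two_le_card_zs (hG : IsGrape G u) (h2 : 2 ≤ (cycles G).encard)
    (hF : ∀ x y (hx : x ≠ u) (hy : y ≠ u), F.top x = F.top y ↔ compOf G hx = compOf G hy) :
    2 ≤ #F.zs := by
  obtain ⟨s, t, hs, ht, hst⟩ := Set.one_lt_encard_iff.1 (lt_of_lt_of_le (by norm_num) h2)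
  have key : ∀ s ∈ cycles G, ∃ z ∈ F.Z, s(u, z) ∈ s := by
    intro s hs
    obtain ⟨e, he, hue⟩ := hG.2.2 s hs
    obtain ⟨x, y, hx, hy, hxy, hxs, hys, hc⟩ := exists_adj_of_mem_cycles hs he hue
    rcases adj_root_iff.1 hx with h | h
    · rcases adj_root_iff.1 hy with h' | h'
      · rw [mem_ch] at h h'
        rw [← hF _ _ hx.ne' hy.ne', F.top_of_par_eq x h.1 h.2, F.top_of_par_eq y h'.1 h'.2] at hc
        exact absurd hc hxy
      · exact ⟨y, h', hys⟩
    · exact ⟨x, h, hxs⟩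
  obtain ⟨z, hz, hzs⟩ := key s hs
  obtain ⟨z', hz', hzt⟩ := key t ht
  refine one_lt_card.2 ⟨z, F.mem_zs.2 hz, z', F.mem_zs.2 hz', ?_⟩
  rintro rfl
  exact Set.disjoint_left.1 (hG.1.2 hs ht hst) hzs hzt

end Frame


/-! ### Berries -/

section
variable {V W : Type*} {G : SimpleGraph V} {u : V}

lemma deg_eq_of_subtype {H : SimpleGraph V} {s : Set V} {H' : SimpleGraph s} {a : s}
    (hadj : ∀ b, H'.Adj a b ↔ H.Adj a b) (hs : ∀ b, H.Adj a b → b ∈ s) : deg H' a = deg H a := by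
  have : Subtype.val '' H'.neighborSet a = H.neighborSet (a : V) := by
    ext b
    constructor
    · rintro ⟨c, hc, rfl⟩
      exact (hadj c).1 hc
    · intro hb
      exact ⟨⟨b, hs b hb⟩, (hadj _).2 hb, rfl⟩
  rw [deg, deg, ← this, Set.ncard_image_of_injective _ Subtype.val_injective]

variable {K : (G.induce ({u}ᶜ : Set V)).ConnectedComponent}

@[simp] lemma berry_adj {a b : berrySet G u K} : (berry G u K).Adj a b ↔ G.Adj a b := Iff.rfl

@[simp] lemma labelGraph_berryColoring_adj {L : Type*} (C : G.EdgeLabeling L) (k : L)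
    {a b : berrySet G u K} :
    ((berryColoring C u K).labelGraph k).Adj a b ↔ (C.labelGraph k).Adj a b := by
  rw [SimpleGraph.EdgeLabeling.labelGraph_adj, SimpleGraph.EdgeLabeling.labelGraph_adj]
  exact Iff.rfl

/-- Hence a berry keeps all degrees and colour degrees of `G` except those at the root. -/
lemma mem_berrySet_of_adj {a : berrySet G u K} (ha : (a : V) ≠ u) {b : V} (h : G.Adj a b) :
    b ∈ berrySet G u K := by
  by_cases hb : b = u
  · rw [hb]; exact Set.mem_insert _ _
  · rw [mem_berrySet]
    refine .inr ⟨hb, ?_⟩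
    rcases mem_berrySet.1 a.2 with h' | ⟨h', e⟩
    · exact absurd h' ha
    · rw [← e]
      exact (compOf_eq_of_adj ha hb h).symm

lemma deg_berry {a : berrySet G u K} (ha : (a : V) ≠ u) : deg (berry G u K) a = deg G a :=
  deg_eq_of_subtype (fun _ => berry_adj) fun _ h => mem_berrySet_of_adj ha h

lemma colorDeg_berryColoring {L : Type*} (C : G.EdgeLabeling L) (k : L) {a : berrySet G u K}
    (ha : (a : V) ≠ u) : colorDeg (berryColoring C u K) k a = colorDeg C k a :=
  deg_eq_of_subtype (fun _ => labelGraph_berryColoring_adj C k) fun _ h =>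
    mem_berrySet_of_adj ha (C.labelGraph_le h)

lemma edgeIrregular_berryColoring {C : G.EdgeLabeling (Fin 3)} (hC : IsLiec C)
    {a b : berrySet G u K} (ha : (a : V) ≠ u) (hb : (b : V) ≠ u) :
    EdgeIrregular (berryColoring C u K) a b := by
  intro k h
  rw [colorDeg_berryColoring C k ha, colorDeg_berryColoring C k hb]
  exact hC k _ _ ((labelGraph_berryColoring_adj C k).1 h)

lemma color_unique {L : Type*} {C : G.EdgeLabeling L} {j k : L} {x y : V}
    (hj : (C.labelGraph j).Adj x y) (hk : (C.labelGraph k).Adj x y) : j = k := by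
  rw [SimpleGraph.EdgeLabeling.labelGraph_adj] at hj hk
  obtain ⟨h, rfl⟩ := hj
  obtain ⟨_, rfl⟩ := hk
  rfl

lemma three_le_deg [Finite V] {x a b c : V} (ha : G.Adj x a) (hb : G.Adj x b) (hc : G.Adj x c)
    (hab : a ≠ b) (hac : a ≠ c) (hbc : b ≠ c) : 3 ≤ deg G x := by
  classical
  have h : (({a, b, c} : Finset V) : Set V) ⊆ G.neighborSet x := by
    intro y hy
    simp at hy
    rcases hy with rfl | rfl | rfl <;> simpa
  have := Set.ncard_le_ncard h (Set.toFinite _)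
  rwa [Set.ncard_coe_finset, card_eq_three.2 ⟨a, b, c, hab, hac, hbc, rfl⟩] at this

lemma deg_eq_of_iso {H : SimpleGraph W} (e : G ≃g H) (x : V) : deg G x = deg H (e x) := by
  have : e '' G.neighborSet x = H.neighborSet (e x) := by
    ext b
    constructor
    · rintro ⟨c, hc, rfl⟩
      exact e.map_adj_iff.2 hc
    · intro hb
      refine ⟨e.symm b, ?_, e.apply_symm_apply b⟩
      rw [SimpleGraph.mem_neighborSet] at hb ⊢
      rw [← e.map_adj_iff, e.apply_symm_apply]
      exact hb
  rw [deg, deg, ← this, Set.ncard_image_of_injective _ e.injective]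

/-- A property of the alternative berries other than `B₇`. -/
lemma exists_of_isAlternative (h : IsAlternative G u) (h7 : ¬ RootedIso G u B7 0) :
    ∃ v w, v ≠ w ∧ G.Adj u v ∧ G.Adj u w ∧ (G.Adj v w ∨ ∃ a b, a ≠ b ∧ a ≠ u ∧ b ≠ u ∧
      G.Adj w a ∧ G.Adj w b) := by
  have key : ∀ {n : ℕ} {H : SimpleGraph (Fin (n + 3))}, RootedIso G u H 0 →
      H.Adj 0 1 → H.Adj 0 2 → (H.Adj 1 2 ∨ ∃ a b, a ≠ b ∧ a ≠ 0 ∧ b ≠ 0 ∧ H.Adj 2 a ∧ H.Adj 2 b) →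
      ∃ v w, v ≠ w ∧ G.Adj u v ∧ G.Adj u w ∧ (G.Adj v w ∨ ∃ a b, a ≠ b ∧ a ≠ u ∧ b ≠ u ∧
      G.Adj w a ∧ G.Adj w b) := by
    rintro n H ⟨e, he⟩ h1 h2 h3
    have hu : e.symm 0 = u := by rw [← he, e.symm_apply_apply]
    have hadj : ∀ {a b}, H.Adj a b → G.Adj (e.symm a) (e.symm b) := fun h => e.symm.map_adj_iff.2 h
    refine ⟨e.symm 1, e.symm 2, e.symm.injective.ne ?_, hu ▸ hadj h1, hu ▸ hadj h2, ?_⟩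
    · intro h
      have := congrArg Fin.val h
      simp [Fin.val_two, Nat.mod_eq_of_lt] at this
    · rcases h3 with h3 | ⟨a, b, hab, ha, hb, h4, h5⟩
      · exact .inl (hadj h3)
      · exact .inr ⟨e.symm a, e.symm b, e.symm.injective.ne hab, hu ▸ e.symm.injective.ne ha,
          hu ▸ e.symm.injective.ne hb, hadj h4, hadj h5⟩
  -- Apart from `B₇`, only `B₅` lacks a triangle at the root; there the vertex `2` has the two
  -- neighbours `18` and `10` besides the root.
  rcases h with h | h | h | h | h | h | h | h
  · exact key h (by simp [B1, ofEdges]) (by simp [B1, ofEdges]) (.inl (by simp [B1, ofEdges]))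
  · exact key h (by simp [B2, ofEdges]) (by simp [B2, ofEdges]) (.inl (by simp [B2, ofEdges]))
  · exact key h (by simp [B2', ofEdges]) (by simp [B2', ofEdges]) (.inl (by simp [B2', ofEdges]))
  · exact key h (by simp [B3, ofEdges]) (by simp [B3, ofEdges]) (.inl (by simp [B3, ofEdges]))
  · exact key h (by simp [B4, ofEdges]) (by simp [B4, ofEdges]) (.inl (by simp [B4, ofEdges]))
  · exact key h (by simp [B5, ofEdges]) (by simp [B5, ofEdges])
      (.inr ⟨18, 10, by decide, by decide, by decide, by simp [B5, ofEdges], by simp [B5, ofEdges]⟩)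
  · exact key h (by simp [B6, ofEdges]) (by simp [B6, ofEdges]) (.inl (by simp [B6, ofEdges]))
  · exact absurd h h7

lemma B7_adj_zero_iff (x : Fin 6) : B7.Adj 0 x ↔ x = 1 := by
  fin_cases x <;> simp [B7, ofEdges]

lemma deg_B7_one : deg B7 1 = 3 := by
  have : B7.neighborSet 1 = (({0, 2, 4} : Finset (Fin 6)) : Set (Fin 6)) := by
    ext x
    rw [SimpleGraph.mem_neighborSet]
    fin_cases x <;> simp [B7, ofEdges]
  rw [deg, this, Set.ncard_coe_finset]
  rfl

/-- The root of `B₇` has a single neighbor, whose degree is `3`. -/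
lemma RootedIso.eq_and_deg {y z : V} (h : RootedIso G u B7 0) (hy : G.Adj u y) (hz : G.Adj u z) :
    y = z ∧ deg G y = 3 := by
  obtain ⟨e, he⟩ := h
  have h1 : ∀ {y}, G.Adj u y → e y = 1 := fun {y} hy => by
    rw [← B7_adj_zero_iff, ← he]
    exact e.map_adj_iff.2 hy
  refine ⟨e.injective ((h1 hy).trans (h1 hz).symm), ?_⟩
  rw [deg_eq_of_iso e, h1 hy, deg_B7_one]

end

/-! ### Restrictions of colourings to the berries -/

namespace Frame

variable {V : Type*} [Fintype V] {G : SimpleGraph V} {u : V} {F : Frame G u}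

/-- The frame fits the components of `G - u`. -/
def FitsComponents (F : Frame G u) : Prop :=
  ∀ x y (hx : x ≠ u) (hy : y ≠ u), F.top x = F.top y ↔ compOf G hx = compOf G hy

/-- The berry below a child `y` of the root is isomorphic to `B₇`. -/
def IsB7At (G : SimpleGraph V) (u y : V) : Prop :=
  ∃ hy : y ≠ u, RootedIso (berry G u (compOf G hy)) (berryRoot G u (compOf G hy)) B7 0

variable {y : V}

lemma exists_mem_ch_compOf_eq (hG : G.Connected) (hF : F.FitsComponents)
    (K : (G.induce ({u}ᶜ : Set V)).ConnectedComponent) :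
    ∃ y ∈ F.ch u, ∃ hy : y ≠ u, compOf G hy = K := by
  obtain ⟨x, hx, rfl⟩ := exists_adj_compOf_eq hG K
  rcases adj_root_iff.1 hx with h | h
  · exact ⟨x, h, hx.ne', rfl⟩
  · have ht := F.mem_ch.1 (top_mem_ch h)
    exact ⟨F.top x, top_mem_ch h, ht.1, (hF _ _ ht.1 hx.ne').1 (F.top_of_par_eq _ ht.1 ht.2)⟩

lemma adj_root_of_mem_ch (hy : y ∈ F.ch u) : G.Adj u y := adj_root_iff.2 (.inl hy)

lemma adj_root_of_mem_Z (hy : y ∈ F.Z) : G.Adj u y := adj_root_iff.2 (.inr hy)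

lemma top_eq_self (hy : y ∈ F.ch u) : F.top y = y :=
  F.top_of_par_eq y (F.mem_ch.1 hy).1 (F.mem_ch.1 hy).2

/-- The neighbors of the root in the berry of its child `y`. -/
lemma berry_adj_root (hF : F.FitsComponents) (hy : y ∈ F.ch u) (hyu : y ≠ u)
    (a : berrySet G u (compOf G hyu)) (ha : (berry G u (compOf G hyu)).Adj (berryRoot G u _) a) :
    (a : V) = y ∨ ((a : V) ∈ F.Z ∧ F.top a = y) := by
  have hadj : G.Adj u a := ha
  rcases mem_berrySet.1 a.2 with h | ⟨h, e⟩
  · exact absurd h hadj.ne'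
  · rw [← hF _ _ h hyu, top_eq_self hy] at e
    rcases adj_root_iff.1 hadj with h' | h'
    · exact .inl ((top_eq_self h').symm.trans e)
    · exact .inr ⟨h', e⟩

lemma mem_berrySet_compOf (hyu : y ≠ u) : y ∈ berrySet G u (compOf G hyu) :=
  mem_berrySet.2 (.inr ⟨hyu, rfl⟩)

lemma mem_berrySet_of_top_eq (hF : F.FitsComponents) (hy : y ∈ F.ch u) (hyu : y ≠ u) {z : V}
    (hz : z ∈ F.Z) (h : F.top z = y) : z ∈ berrySet G u (compOf G hyu) := by
  refine mem_berrySet.2 (.inr ⟨F.ne_root z hz, (hF _ _ _ _).1 ?_⟩)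
  rw [h, top_eq_self hy]

lemma deg_berryRoot_eq_one (hF : F.FitsComponents) (hy : y ∈ F.ch u) (hyu : y ≠ u)
    (h : ∀ z ∈ F.Z, F.top z ≠ y) :
    deg (berry G u (compOf G hyu)) (berryRoot G u (compOf G hyu)) = 1 := by
  rw [deg, Set.ncard_eq_one]
  refine ⟨⟨y, mem_berrySet_compOf hyu⟩, ?_⟩
  ext a
  rw [SimpleGraph.mem_neighborSet, Set.mem_singleton_iff]
  constructor
  · intro ha
    rcases berry_adj_root hF hy hyu a ha with h' | h'
    · exact Subtype.ext h'
    · exact absurd h'.2 (h _ h'.1)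
  · rintro rfl
    exact berry_adj.2 (adj_root_of_mem_ch hy)

lemma deg_berryRoot_eq_two (hF : F.FitsComponents) (hy : y ∈ F.ch u) (hyu : y ≠ u) {z : V}
    (hz : z ∈ F.Z) (h : F.top z = y) :
    deg (berry G u (compOf G hyu)) (berryRoot G u (compOf G hyu)) = 2 := by
  rw [deg, Set.ncard_eq_two]
  refine ⟨⟨y, mem_berrySet_compOf hyu⟩, ⟨z, mem_berrySet_of_top_eq hF hy hyu hz h⟩, ?_, ?_⟩
  · intro e
    have : y = z := congrArg Subtype.val e
    exact notMem_Z_of_mem_ch_root hy (this ▸ hz)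
  · ext a
    rw [SimpleGraph.mem_neighborSet, Set.mem_insert_iff, Set.mem_singleton_iff]
    constructor
    · intro ha
      rcases berry_adj_root hF hy hyu a ha with h' | h'
      · exact .inl (Subtype.ext h')
      · exact .inr (Subtype.ext (F.injOn_top h'.1 hz (h'.2.trans h.symm)))
    · rintro (rfl | rfl)
      · exact berry_adj.2 (adj_root_of_mem_ch hy)
      · exact berry_adj.2 (adj_root_of_mem_Z hz)

lemma not_isB7At_of_mem_Z (hF : F.FitsComponents) (hy : y ∈ F.ch u) {z : V}
    (hz : z ∈ F.Z) (h : F.top z = y) : ¬ IsB7At G u y := by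
  rintro ⟨hyu, hi⟩
  have h1 : (berry G u (compOf G hyu)).Adj (berryRoot G u _) ⟨y, mem_berrySet_compOf hyu⟩ :=
    berry_adj.2 (adj_root_of_mem_ch hy)
  have h2 : (berry G u (compOf G hyu)).Adj (berryRoot G u _)
      ⟨z, mem_berrySet_of_top_eq hF hy hyu hz h⟩ := berry_adj.2 (adj_root_of_mem_Z hz)
  have : y = z := congrArg Subtype.val (hi.eq_and_deg h1 h2).1
  exact notMem_Z_of_mem_ch_root hy (this ▸ hz)

lemma deg_of_isB7At (hy : y ∈ F.ch u) (h : IsB7At G u y) : deg G y = 3 := by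
  obtain ⟨hyu, hi⟩ := h
  have h1 : (berry G u (compOf G hyu)).Adj (berryRoot G u _) ⟨y, mem_berrySet_compOf hyu⟩ :=
    berry_adj.2 (adj_root_of_mem_ch hy)
  have := (hi.eq_and_deg h1 h1).2
  rwa [deg_berry hyu] at this

lemma card_ch_of_isB7At (hy : y ∈ F.ch u) (h : IsB7At G u y) :
    #(F.ch y) = 2 := by
  classical
  have := deg_of_isB7At hy h
  rw [F.deg_eq y (F.mem_ch.1 hy).1, if_neg (notMem_Z_of_mem_ch_root hy)] at this
  omega

/-- The berry of an acyclic component. -/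
lemma isPrimary_of_acyclic (hF : F.FitsComponents) {C : G.EdgeLabeling (Fin 3)} (hC : IsLiec C)
    (hy : y ∈ F.ch u) (hyu : y ≠ u) (h : ∀ z ∈ F.Z, F.top z ≠ y) {c : Fin 3}
    (hc : (C.labelGraph c).Adj u y) (h2 : ¬ IsB7At G u y → colorDeg C c y ≤ 2)
    (h3 : IsB7At G u y → colorDeg C c y = 3) :
    IsPrimary (berryRoot G u (compOf G hyu)) (berryColoring C u (compOf G hyu)) := by
  have hd := deg_berryRoot_eq_one hF hy hyu h
  have hnb : ∀ a, (berry G u (compOf G hyu)).Adj (berryRoot G u _) a → (a : V) = y := by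
    intro a ha
    rcases berry_adj_root hF hy hyu a ha with h' | h'
    · exact h'
    · exact absurd h'.2 (h _ h'.1)
  let y' : berrySet G u (compOf G hyu) := ⟨y, mem_berrySet_compOf hyu⟩
  have hnr : ∀ a : berrySet G u (compOf G hyu), a ≠ berryRoot G u _ → (a : V) ≠ u :=
    fun a ha e => ha (Subtype.ext e)
  by_cases hX : IsB7At G u y
  · refine ⟨fun _ => .inl ⟨hd, fun k a b hab => ?_, y', c, berry_adj.2 (adj_root_of_mem_ch hy), fun a ha => ?_⟩,
      fun hn => absurd (by obtain ⟨_, hi⟩ := hX; exact (by unfold IsAlternative; tauto)) hn⟩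
    · have root : ∀ k a, ((berryColoring C u (compOf G hyu)).labelGraph k).Adj (berryRoot G u _) a →
          deg ((berryColoring C u (compOf G hyu)).labelGraph k) (berryRoot G u _) ≠
          deg ((berryColoring C u (compOf G hyu)).labelGraph k) a := by
        intro k a ha
        have hay := hnb a (SimpleGraph.EdgeLabeling.labelGraph_le _ ha)
        have hay' : a = y' := Subtype.ext hay
        subst hay'
        have hk : k = c := color_unique ((labelGraph_berryColoring_adj C k).1 ha) hc
        subst hk
        have e1 := colorDeg_berryColoring C k (a := y') hyu
        rw [h3 hX, colorDeg] at e1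
        rw [e1]
        have hle : deg ((berryColoring C u (compOf G hyu)).labelGraph k) (berryRoot G u _) ≤
            deg (berry G u (compOf G hyu)) (berryRoot G u _) :=
          Set.ncard_le_ncard (fun b hb =>
            SimpleGraph.EdgeLabeling.labelGraph_le (berryColoring C u (compOf G hyu)) hb)
            (Set.toFinite _)
        omega
      by_cases ha : a = berryRoot G u _
      · subst ha; exact root k b hab
      by_cases hb : b = berryRoot G u _
      · subst hb; exact (root k a hab.symm).symm
      exact edgeIrregular_berryColoring hC (hnr a ha) (hnr b hb) k hab
    · rw [labelGraph_berryColoring_adj]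
      have e1 : deg G y = 3 := deg_of_isB7At hy hX
      -- Colour degree `3` equals the degree of `y`, so all edges at `y` have the colour `c`.
      have e2 : (C.labelGraph c).neighborSet y = G.neighborSet y := by
        refine Set.eq_of_subset_of_ncard_le (fun b hb => C.labelGraph_le hb) ?_ (Set.toFinite _)
        have := h3 hX
        unfold colorDeg deg at this
        unfold deg at e1
        omega
      have : (a : V) ∈ G.neighborSet y := ha
      rwa [← e2] at this
  · refine ⟨fun ha => ?_, fun _ => ⟨.inl hd, fun a b _ ha hb =>
      edgeIrregular_berryColoring hC (hnr a ha) (hnr b hb), c, fun a ha => ?_⟩⟩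
    · obtain ⟨v, w, hvw, hv, hw, -⟩ := exists_of_isAlternative ha fun hi => hX ⟨hyu, hi⟩
      exact absurd (Subtype.ext ((hnb v hv).trans (hnb w hw).symm)) hvw
    · have hay := hnb a ha
      rw [labelGraph_berryColoring_adj, colorDeg_berryColoring C c (by rwa [hay]), hay]
      exact ⟨hc, h2 hX⟩

/-- The berry of a long cycle without branches next to the root. -/
lemma isPrimary_of_long (hF : F.FitsComponents) {C : G.EdgeLabeling (Fin 3)} (hC : IsLiec C)
    (hy : y ∈ F.ch u) (hyu : y ≠ u) {z : V} (hz : z ∈ F.Z) (h : F.top z = y) (hl : F.Long z)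
    (hch : F.ch z = ∅) {c : Fin 3} (hcy : (C.labelGraph c).Adj u y)
    (hcz : (C.labelGraph c).Adj u z) (h2 : colorDeg C c y ≤ 2) (h1 : colorDeg C c z ≤ 2) :
    IsPrimary (berryRoot G u (compOf G hyu)) (berryColoring C u (compOf G hyu)) := by
  classical
  have hd := deg_berryRoot_eq_two hF hy hyu hz h
  have hzu := F.ne_root z hz
  have hnb : ∀ a, (berry G u (compOf G hyu)).Adj (berryRoot G u _) a →
      (a : V) = y ∨ (a : V) = z := by
    intro a ha
    refine (berry_adj_root hF hy hyu a ha).imp_right fun h' => ?_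
    exact F.injOn_top h'.1 hz (h'.2.trans h.symm)
  have hnr : ∀ a : berrySet G u (compOf G hyu), a ≠ berryRoot G u _ → (a : V) ≠ u :=
    fun a ha e => ha (Subtype.ext e)
  have hyz : ¬ G.Adj y z := by
    rw [F.adj_iff', mem_ch, mem_ch, (F.mem_ch.1 hy).2]
    have := hl.2
    rw [h] at this
    tauto
  have hdy : deg G y = 2 := by
    have := hl.1
    rw [h] at this
    rw [F.deg_eq y hyu, if_neg (notMem_Z_of_mem_ch_root hy), this]
  have hdz : deg G z = 2 := by
    rw [F.deg_eq z hzu, if_pos hz, hch]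
    simp
  refine ⟨fun ha => ?_, fun _ => ⟨.inr hd, fun a b _ ha hb =>
      edgeIrregular_berryColoring hC (hnr a ha) (hnr b hb), c, fun a ha => ?_⟩⟩
  -- The berry is standard: its two root neighbours are not adjacent and both have degree `2`, which
  -- no alternative berry with two root neighbours allows.
  · obtain ⟨v, w, hvw, hv, hw, h'⟩ := exists_of_isAlternative ha fun hi =>
      not_isB7At_of_mem_Z hF hy hz h ⟨hyu, hi⟩
    have hvw' : (v : V) ≠ w := fun e => hvw (Subtype.ext e)
    exfalso
    rcases h' with h' | ⟨a, b, hab, ha, hb, hwa, hwb⟩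
    · rw [berry_adj] at h'
      rcases hnb v hv with e1 | e1 <;> rcases hnb w hw with e2 | e2
      · exact hvw' (e1.trans e2.symm)
      · rw [e1, e2] at h'; exact hyz h'
      · rw [e1, e2] at h'; exact hyz h'.symm
      · exact hvw' (e1.trans e2.symm)
    · have h3 := three_le_deg hw.symm hwa hwb ha.symm hb.symm hab
      have hwu : (w : V) ≠ u := hnr w hw.ne'
      rw [deg_berry hwu] at h3
      rcases hnb w hw with e2 | e2 <;> rw [e2] at h3 <;> omega
  · rcases hnb a ha with e | e
    · rw [labelGraph_berryColoring_adj, colorDeg_berryColoring C c (by rwa [e]), e]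
      exact ⟨hcy, h2⟩
    · rw [labelGraph_berryColoring_adj, colorDeg_berryColoring C c (by rwa [e]), e]
      exact ⟨hcz, h1⟩

/-- The berry of a cycle whose two edges at the root have distinct colors. -/
lemma isSecondary_of_ne (hF : F.FitsComponents) {C : G.EdgeLabeling (Fin 3)} (hC : IsLiec C)
    (hy : y ∈ F.ch u) (hyu : y ≠ u) {z : V} (hz : z ∈ F.Z) (h : F.top z = y)
    {c a : Fin 3} (hca : c ≠ a) (hcy : (C.labelGraph a).Adj u y)
    (hcz : (C.labelGraph c).Adj u z) (h2 : 2 ≤ colorDeg C a y) (h1 : colorDeg C c z = 1) :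
    IsSecondary (berryRoot G u (compOf G hyu)) (berryColoring C u (compOf G hyu)) := by
  have hd := deg_berryRoot_eq_two hF hy hyu hz h
  have hzu := F.ne_root z hz
  have hnb : ∀ a, (berry G u (compOf G hyu)).Adj (berryRoot G u _) a →
      (a : V) = y ∨ (a : V) = z := by
    intro a ha
    refine (berry_adj_root hF hy hyu a ha).imp_right fun h' => ?_
    exact F.injOn_top h'.1 hz (h'.2.trans h.symm)
  have hnr : ∀ a : berrySet G u (compOf G hyu), a ≠ berryRoot G u _ → (a : V) ≠ u :=
    fun a ha e => ha (Subtype.ext e)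
  let y' : berrySet G u (compOf G hyu) := ⟨y, mem_berrySet_compOf hyu⟩
  let z' : berrySet G u (compOf G hyu) := ⟨z, mem_berrySet_of_top_eq hF hy hyu hz h⟩
  have hzy : z' ≠ y' := by
    intro e
    have : z = y := congrArg Subtype.val e
    exact notMem_Z_of_mem_ch_root hy (this ▸ hz)
  have hroot : colorDeg (berryColoring C u (compOf G hyu)) a (berryRoot G u _) = 1 := by
    rw [colorDeg, deg, Set.ncard_eq_one]
    refine ⟨y', ?_⟩
    ext b
    rw [SimpleGraph.mem_neighborSet, Set.mem_singleton_iff]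
    constructor
    · intro hb
      rcases hnb b (SimpleGraph.EdgeLabeling.labelGraph_le _ hb) with e | e
      · exact Subtype.ext e
      · have hb' : (C.labelGraph a).Adj u b := (labelGraph_berryColoring_adj C a).1 hb
        rw [e] at hb'
        exact absurd (color_unique hcz hb') hca
    · rintro rfl
      exact (labelGraph_berryColoring_adj C a).2 hcy
  have hyroot : ∀ k, ((berryColoring C u (compOf G hyu)).labelGraph k).Adj (berryRoot G u _) y' →
      colorDeg (berryColoring C u (compOf G hyu)) k (berryRoot G u _) ≠
      colorDeg (berryColoring C u (compOf G hyu)) k y' := by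
    intro k hk
    obtain rfl := color_unique hcy ((labelGraph_berryColoring_adj C k).1 hk)
    rw [hroot, colorDeg_berryColoring C a (a := y') hyu]
    change 1 ≠ colorDeg C a y
    omega
  -- The exempted edge is `uz`: inside the berry both of its ends have colour degree `1`. The edge
  -- `uy` is irregular because the root has degree `1` in its colour and `y` at least `2`.
  refine ⟨fun hi => not_isB7At_of_mem_Z hF hy hz h ⟨hyu, hi⟩, .inr ⟨hd, z', y', c, a, hzy, hca,
    (labelGraph_berryColoring_adj C c).2 hcz, (labelGraph_berryColoring_adj C a).2 hcy,
    fun b b' hbb hne => ?_, ?_, ?_⟩⟩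
  · by_cases hb : b = berryRoot G u _
    · subst hb
      rcases hnb b' hbb with e | e
      · obtain rfl : b' = y' := Subtype.ext e
        exact fun k hk => hyroot k hk
      · obtain rfl : b' = z' := Subtype.ext e
        exact absurd rfl hne
    by_cases hb' : b' = berryRoot G u _
    · subst hb'
      rcases hnb b hbb.symm with e | e
      · obtain rfl : b = y' := Subtype.ext e
        exact fun k hk => (hyroot k hk.symm).symm
      · obtain rfl : b = z' := Subtype.ext e
        exact absurd Sym2.eq_swap hne
    exact edgeIrregular_berryColoring hC (hnr b hb) (hnr b' hb')
  · rw [colorDeg_berryColoring C c (a := z') hzu]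
    change colorDeg C c z ≤ 2
    omega
  · rw [colorDeg_berryColoring C c (a := z') hzu]
    change colorDeg C c z = 2 → _
    omega

end Frame


/-! ### Recognising the exceptional grape, and conclusion -/

namespace Frame

variable {V : Type*} [Fintype V] {G : SimpleGraph V} {u : V} {F : Frame G u}

/-- The cycle through `uz` is a triangle without branches. -/
lemma eq_or_eq_of_triangle {z : V} (h0 : F.ch z = ∅) (h1 : F.ch (F.top z) = {z}) {x : V}
    (hx : x ≠ u) (h : F.top x = F.top z) : x = F.top z ∨ x = z := by
  induction hn : F.ht x using Nat.strong_induction_on generalizing x with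
  | _ n ih =>
    by_cases hp : F.par x = u
    · exact .inl (by rw [← h, F.top_of_par_eq x hx hp])
    · have hm : x ∈ F.ch (F.par x) := by simp [hx]
      rcases ih _ (hn ▸ F.ht_par x hx) hp (by rw [F.top_par x hx hp, h]) rfl with e | e
      · rw [e, h1] at hm
        exact .inr (by simpa using hm)
      · rw [e, h0] at hm
        simp at hm

lemma not_adj_of_top_ne (hF : F.FitsComponents) {x y : V} (hx : x ≠ u) (hy : y ≠ u)
    (h : F.top x ≠ F.top y) : ¬ G.Adj x y := fun hadj =>
  h ((hF x y hx hy).2 (compOf_eq_of_adj hx hy hadj))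

/-- The embedding of `B₇` as a berry. -/
lemma exists_of_isB7At (hF : F.FitsComponents) {t : V} (ht : t ∈ F.ch u) (h : IsB7At G u t) :
    ∃ ψ : Fin 6 → V, Function.Injective ψ ∧ ψ 0 = u ∧ (∀ i, i ≠ 0 → ψ i ≠ u ∧ F.top (ψ i) = t) ∧
      (∀ x, x ≠ u → F.top x = t → ∃ i, i ≠ 0 ∧ ψ i = x) ∧
      ∀ i j, G.Adj (ψ i) (ψ j) ↔ B7.Adj i j := by
  obtain ⟨htu, e, he⟩ := h
  have h0 : (e.symm 0 : V) = u := by rw [← he, e.symm_apply_apply]; rfl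
  have hinj : Function.Injective fun i => (e.symm i : V) :=
    Subtype.val_injective.comp e.symm.injective
  refine ⟨fun i => e.symm i, hinj, h0, fun i hi => ?_, fun x hx hxt => ?_, fun i j => ?_⟩
  · have hne : (e.symm i : V) ≠ u := fun h => hi (hinj (h.trans h0.symm))
    refine ⟨hne, ?_⟩
    rcases mem_berrySet.1 (e.symm i).2 with h | ⟨h, h'⟩
    · exact absurd h hne
    · exact ((hF _ _ h htu).2 h').trans (top_eq_self ht)
  · have hm : x ∈ berrySet G u (compOf G htu) :=
      mem_berrySet.2 (.inr ⟨hx, (hF _ _ hx htu).1 (by rw [hxt, top_eq_self ht])⟩)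
    have hx' : (e.symm (e ⟨x, hm⟩) : V) = x := by rw [e.symm_apply_apply]
    refine ⟨e ⟨x, hm⟩, fun h => ?_, hx'⟩
    rw [h] at hx'
    exact hx (hx'.symm.trans h0)
  · rw [← e.symm.map_adj_iff]
    exact Iff.rfl

/-- A grape with three berries two of which are triangles and the third one of which is `B₇`. -/
lemma nonempty_iso_BPrime (hF : F.FitsComponents) {z₁ z₂ t : V} (h₁ : z₁ ∈ F.Z) (h₂ : z₂ ∈ F.Z)
    (h₁₂ : z₁ ≠ z₂) (ht : t ∈ F.ch u) (htZ : ∀ z ∈ F.Z, F.top z ≠ t) (hB : IsB7At G u t)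
    (hu : ∀ y ∈ F.ch u, y = F.top z₁ ∨ y = F.top z₂ ∨ y = t)
    (hc : ∀ z ∈ F.Z, F.ch z = ∅ ∧ F.ch (F.top z) = {z}) : Nonempty (G ≃g BPrime) := by
  obtain ⟨ψ, hψi, hψ0, hψu, hψs, hψa⟩ := exists_of_isB7At hF ht hB
  set y₁ := F.top z₁ with hy₁
  set y₂ := F.top z₂ with hy₂
  have m₁ := top_mem_ch h₁
  have m₂ := top_mem_ch h₂
  rw [← hy₁] at m₁
  rw [← hy₂] at m₂
  have u₁ := F.ne_root z₁ h₁
  have u₂ := F.ne_root z₂ h₂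
  have v₁ := (F.mem_ch.1 m₁).1
  have v₂ := (F.mem_ch.1 m₂).1
  have t₁ : F.top y₁ = y₁ := top_eq_self m₁
  have t₂ : F.top y₂ = y₂ := top_eq_self m₂
  have n₁₂ : y₁ ≠ y₂ := fun h => h₁₂ (F.injOn_top h₁ h₂ h)
  have nt₁ : y₁ ≠ t := htZ z₁ h₁
  have nt₂ : y₂ ≠ t := htZ z₂ h₂
  have yz₁ : y₁ ≠ z₁ := fun h => notMem_Z_of_mem_ch_root m₁ (h ▸ h₁)
  have yz₂ : y₂ ≠ z₂ := fun h => notMem_Z_of_mem_ch_root m₂ (h ▸ h₂)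
  have a1 : G.Adj u y₁ := adj_root_of_mem_ch m₁
  have a2 : G.Adj u y₂ := adj_root_of_mem_ch m₂
  have a3 : G.Adj u z₁ := adj_root_of_mem_Z h₁
  have a4 : G.Adj u z₂ := adj_root_of_mem_Z h₂
  have a5 : G.Adj y₁ z₁ := by
    rw [F.adj_iff', (hc z₁ h₁).2]; simp
  have a6 : G.Adj y₂ z₂ := by
    rw [F.adj_iff', (hc z₂ h₂).2]; simp
  -- The order follows the numbering of `BPrime`: root, two triangles, then the non-root vertices of
  -- `B₇`.
  let φ : Fin 10 → V := ![u, y₁, z₁, y₂, z₂, ψ 1, ψ 2, ψ 3, ψ 4, ψ 5]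
  have far : ∀ {x y}, x ≠ u → y ≠ u → F.top x ≠ F.top y → ¬ G.Adj x y ∧ ¬ G.Adj y x ∧
      x ≠ y ∧ y ≠ x := fun hx hy h => ⟨not_adj_of_top_ne hF hx hy h,
        not_adj_of_top_ne hF hy hx h.symm, fun e => h (by rw [e]), fun e => h (by rw [e])⟩
  have f1 := far v₁ v₂ (by rwa [t₁, t₂])
  have f2 := far v₁ u₂ (by rwa [t₁, ← hy₂])
  have f3 := far u₁ v₂ (by rwa [t₂, ← hy₁])
  have f4 := far u₁ u₂ (by rwa [← hy₁, ← hy₂])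
  have g1 := fun (i : Fin 6) (hi : i ≠ 0) =>
    far v₁ (hψu i hi).1 (by rwa [t₁, (hψu i hi).2])
  have g2 := fun (i : Fin 6) (hi : i ≠ 0) =>
    far u₁ (hψu i hi).1 (by rwa [(hψu i hi).2, ← hy₁])
  have g3 := fun (i : Fin 6) (hi : i ≠ 0) =>
    far v₂ (hψu i hi).1 (by rwa [t₂, (hψu i hi).2])
  have g4 := fun (i : Fin 6) (hi : i ≠ 0) =>
    far u₂ (hψu i hi).1 (by rwa [(hψu i hi).2, ← hy₂])
  have hψ0' : ∀ j, G.Adj u (ψ j) ↔ B7.Adj 0 j := fun j => by rw [← hψ0, hψa]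
  have hψ0'' : ∀ j, G.Adj (ψ j) u ↔ B7.Adj j 0 := fun j => by rw [← hψ0, hψa]
  have hadj : ∀ i j, G.Adj (φ i) (φ j) ↔ BPrime.Adj i j := by
    intro i j
    fin_cases i <;> fin_cases j <;>
      simp [φ, a1, a2, a3, a4, a5, a6, a1.symm, a2.symm, a3.symm, a4.symm, a5.symm, a6.symm,
        f1, f2, f3, f4, g1, g2, g3, g4, hψa, hψ0', hψ0''] <;> simp [BPrime, B7, ofEdges]
  have hinj : Function.Injective φ := by
    have hp : ∀ i, i ≠ 0 → ψ i ≠ u ∧ u ≠ ψ i := fun i hi => ⟨(hψu i hi).1, (hψu i hi).1.symm⟩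
    intro i j
    fin_cases i <;> fin_cases j <;>
      simp [φ, u₁, u₂, v₁, v₂, u₁.symm, u₂.symm, v₁.symm, v₂.symm, yz₁, yz₂, yz₁.symm, yz₂.symm,
        f1, f2, f3, f4, g1, g2, g3, g4, hp, hψi.eq_iff]
  have hsurj : Function.Surjective φ := by
    intro x
    by_cases hx : x = u
    · exact ⟨0, by simp [φ, hx]⟩
    have hm : F.top x ∈ F.ch u := by
      induction hn : F.ht x using Nat.strong_induction_on generalizing x with
      | _ n ih =>
        by_cases hp : F.par x = u
        · rw [F.top_of_par_eq x hx hp]; simp [hx, hp]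
        · rw [← F.top_par x hx hp]
          exact ih _ (hn ▸ F.ht_par x hx) _ hp rfl
    rcases hu _ hm with h | h | h
    · rcases eq_or_eq_of_triangle (hc z₁ h₁).1 (hc z₁ h₁).2 hx h with e | e
      · exact ⟨1, by simp [φ, e, hy₁]⟩
      · exact ⟨2, by simp [φ, e]⟩
    · rcases eq_or_eq_of_triangle (hc z₂ h₂).1 (hc z₂ h₂).2 hx h with e | e
      · exact ⟨3, by simp [φ, e, hy₂]⟩
      · exact ⟨4, by simp [φ, e]⟩
    · obtain ⟨i, hi, rfl⟩ := hψs x hx h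
      fin_cases i
      · exact absurd rfl hi
      · exact ⟨5, rfl⟩
      · exact ⟨6, rfl⟩
      · exact ⟨7, rfl⟩
      · exact ⟨8, rfl⟩
      · exact ⟨9, rfl⟩
  exact ⟨(⟨Equiv.ofBijective φ ⟨hinj, hsurj⟩, fun {i j} => hadj i j⟩ : BPrime ≃g G).symm⟩

end Frame

/-- Every grape with at least two cycles has a locally irregular coloring by three colors. -/
theorem IsGrape.exists_isLiec {V : Type*} [Finite V] {G : SimpleGraph V} {u : V}
    (hG : IsGrape G u) (h2 : 2 ≤ (cycles G).encard) :
    ∃ C : G.EdgeLabeling (Fin 3), IsLiec C := by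
  cases nonempty_fintype V
  obtain ⟨F, hdeg, hF⟩ := hG.exists_frame
  obtain ⟨κ, A, q, hv, hA, hZ, -⟩ := Frame.exists_root_coloring (Frame.card_ch_le hdeg)
    (Frame.two_le_card_zs hG h2 hF) (fun _ => False) (fun _ _ h => h.elim)
    (fun _ _ ⟨_, _, h, _⟩ => h.elim)
  obtain ⟨C, hC, -⟩ := Frame.exists_isLiec hv hA hZ
  exact ⟨C, hC⟩

/-- Every grape with at least two cycles other than `B'` has a locally irregular coloring by three
colors whose restrictions to the berries are primary or secondary. -/
theorem IsGrape.exists_isLiec_isPrimary_or_isSecondary {V : Type*} [Finite V] {G : SimpleGraph V}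
    {u : V} (hG : IsGrape G u) (h2 : 2 ≤ (cycles G).encard) (hB : ¬ Nonempty (G ≃g BPrime)) :
    ∃ C : G.EdgeLabeling (Fin 3), IsLiec C ∧
      ∀ K : (G.induce ({u}ᶜ : Set V)).ConnectedComponent,
        IsPrimary (berryRoot G u K) (berryColoring C u K) ∨
        IsSecondary (berryRoot G u K) (berryColoring C u K) := by
  cases nonempty_fintype V
  obtain ⟨F, hdeg, hF⟩ := hG.exists_frame
  have hbal := Frame.card_ch_le hdeg
  -- If every top vertex had a single child and no cycle were `Long`, both cycles would be bare
  -- triangles and, with the `B₇`, would form `B'`.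
  have special : #F.zs = 2 → #(F.ch u) = 3 →
      (∃ y ∈ F.ch u, Frame.IsB7At G u y ∧ ∀ z ∈ F.Z, F.top z ≠ y) →
      ∃ z ∈ F.Z, 2 ≤ #(F.ch (F.top z)) ∨ F.Long z := by
    rintro hz2 hc3 ⟨t, ht, htB, htZ⟩
    by_contra hcon
    push Not at hcon
    classical
    obtain ⟨z₁, z₂, h₁₂, hzs⟩ := card_eq_two.1 hz2
    have h₁ : z₁ ∈ F.Z := by rw [← F.mem_zs, hzs]; simp
    have h₂ : z₂ ∈ F.Z := by rw [← F.mem_zs, hzs]; simp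
    refine hB (Frame.nonempty_iso_BPrime hF h₁ h₂ h₁₂ ht htZ htB (fun y hy => ?_)
      fun z hz => ?_)
    · have hs : ({F.top z₁, F.top z₂, t} : Finset V) = F.ch u := by
        refine eq_of_subset_of_card_le ?_ ?_
        · intro x hx
          simp only [mem_insert, mem_singleton] at hx
          rcases hx with rfl | rfl | rfl
          exacts [Frame.top_mem_ch h₁, Frame.top_mem_ch h₂, ht]
        · rw [hc3, card_eq_three.2 ⟨_, _, _, fun h => h₁₂ (F.injOn_top h₁ h₂ h), htZ z₁ h₁,
            htZ z₂ h₂, rfl⟩]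
      rw [← hs] at hy
      simpa using hy
    · have h1 := Frame.one_le_card_ch_top hz
      have h2 := hcon z hz
      have h3 := hbal z hz
      have h4 : #(F.ch (F.top z)) = 1 := by omega
      refine ⟨card_eq_zero.1 (by omega), ?_⟩
      have hp : F.par z = F.top z := by
        by_contra hp
        exact h2.2 ⟨h4, hp⟩
      obtain ⟨x, hx⟩ := card_eq_one.1 h4
      have hm : z ∈ F.ch (F.top z) := by simp [F.ne_root z hz, hp]
      rw [hx] at hm ⊢
      rw [mem_singleton.1 hm]
  obtain ⟨κ, A, q, hv, hA, hZ, hcyc, hacyc⟩ := Frame.exists_root_coloring hbal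
    (Frame.two_le_card_zs hG h2 hF) (Frame.IsB7At G u)
    (fun y hy h _ => Frame.card_ch_of_isB7At hy h) special
  obtain ⟨C, hC, hCy, hCz⟩ := Frame.exists_isLiec hv hA hZ
  refine ⟨C, hC, fun K => ?_⟩
  obtain ⟨y, hy, hyu, rfl⟩ := Frame.exists_mem_ch_compOf_eq hG.1.1 hF K
  obtain ⟨hcy, hqy⟩ := hCy y hy
  by_cases h : ∃ z ∈ F.Z, F.top z = y
  · obtain ⟨z, hz, rfl⟩ := h
    obtain ⟨hcz, hqz⟩ := hCz z hz
    rcases hcyc z hz with ⟨hl, hκ, hq⟩ | ⟨hκ, hq⟩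
    · rw [← hκ] at hcy hqy
      have h1 := hbal z hz
      have h3 := hl.1
      exact .inl (Frame.isPrimary_of_long hF hC hy hyu hz rfl hl (card_eq_zero.1 (by omega)) hcy
        hcz (by omega) (by omega))
    · exact .inr (Frame.isSecondary_of_ne hF hC hy hyu hz rfl hκ hcy hcz (by omega) hqz)
  · push Not at h
    obtain ⟨hq2, hq3⟩ := hacyc y hy h
    exact .inl (Frame.isPrimary_of_acyclic hF hC hy hyu h hcy (fun hn => by rw [hqy]; exact hq2 hn)
      (fun hX => by rw [hqy]; exact hq3 hX))

end CactusGrape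

theorem mainTheorem4 {V : Type*} [Finite V] (G : SimpleGraph V) (u : V)
    (hG : CactusGrape.IsGrape G u) (h2 : 2 ≤ (CactusGrape.cycles G).encard) :
    (CactusGrape.IsTotallyTrimmed G → ¬ Nonempty (G ≃g CactusGrape.BPrime) →
      ∃ C : G.EdgeLabeling (Fin 3), CactusGrape.IsLiec C ∧
        ∀ K : (G.induce ({u}ᶜ : Set V)).ConnectedComponent,
          CactusGrape.IsPrimary (CactusGrape.berryRoot G u K)
            (CactusGrape.berryColoring C u K) ∨
          CactusGrape.IsSecondary (CactusGrape.berryRoot G u K)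
            (CactusGrape.berryColoring C u K) ∨
          CactusGrape.IsTertiary (CactusGrape.berryRoot G u K)
            (CactusGrape.berryColoring C u K)) ∧
    (CactusGrape.IsColorable G → ∃ C : G.EdgeLabeling (Fin 3), CactusGrape.IsLiec C) := by
  refine ⟨fun _ hB => ?_, fun _ => hG.exists_isLiec h2⟩
  obtain ⟨C, hC, h⟩ := hG.exists_isLiec_isPrimary_or_isSecondary h2 hB
  exact ⟨C, hC, fun K => (h K).imp_right .inl⟩
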